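/- Let $n\ge 2$, let $U\subseteq J^n(\mathbb R,\mathbb R)$ be open, and let $L=f(x,y_0,\dots,y_n)\,dx$ be a smooth Lagrangian on $U$ with $\partial^2 f/\partial y_n^2\neq 0$ everywhere on $U$. Let $$\mathcal E(L)=\Big\{\sum_{k=0}^n(-1)^k\frac{d^k}{dx^k}\frac{\partial f}{\partial y_k}=0\Big\}\subset J^{2n}(\mathbb R,\mathbb R)$$ be its Euler--Lagrange equation over $U$, written in solved form $y_{2n}=F(x,y_0,\dots,y_{2n-1})$, so that $(x,y_0,\dots,y_{2n-1})$ are coordinates on $\mathcal E(L)$. Let $\mathcal E$ be a connected open subset of $\mathcal E(L)$ (for instance all of $\mathcal E(L)$, if $U$ is connected). Let $\mathcal S$ be the line distribution on $\mathcal E$ whose vectors are annihilated by the restrictions to $\mathcal E$ of all contact forms $\theta_i=dy_i-y_{i+1}dx$, $0\le i\le 2n-1$, and let $V^n=\langle \partial/\partial y_n,\dots,\partial/\partial y_{2n-1}\rangle$ be the kernel on $T\mathcal E$ of the differential of the projection to $J^{n-1}(\mathbb R,\mathbb R)$. (a) There is a smooth closed $2$-form $\omega$ on $\mathcal E$ such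 that (1) $\operatorname{Ker}\omega=\mathcal S$, and (2) $\omega$ vanishes on $V^n$. It is unique up to a nonzero constant factor: the $2$-forms with these properties are exactly the forms $c\,\omega$, $c\in\mathbb R\setminus\{0\}$. (b) Let $\mathrm{Sol}$ be the space of leaves of $\mathcal S$ in $\mathcal E$ (the solutions), and suppose that it is a quotient manifold of $\mathcal E$, i.e. it carries a smooth $2n$-dimensional manifold structure for which the projection $\mathrm{pr}\colon\mathcal E\to\mathrm{Sol}$ is a smooth submersion. For a solution $\Gamma\in\mathrm{Sol}$ and $\varepsilon\in\Gamma$ put $\mathrm{Lin}^n_\Gamma(\varepsilon)=\mathrm{pr}_*(V^n_\varepsilon)\subset T_\Gamma\mathrm{Sol}$. Then there is a symplectic structure $\bar\omega$ on $\mathrm{Sol}$ such that (2') for every $\Gamma$ the linearization $\mathrm{Lin}^n_\Gamma$ is a curve of Lagrangian subspaces, that is, each $\mathrm{Lin}^n_\Gamma(\varepsilon)$, $\varepsilon\in\Gamma$, is a Lagrangian subspace of $(T_\Gamma\mathrm{Sol},\bar\omega_\Gamma)$. It is unique up to a nonzero constant factor. (c) The two assertions correspond to each other: if $\omega=\mathrm{pr}^*\bar\omega$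 for a $2$-form $\bar\omega$ on $\mathrm{Sol}$, then $\omega$ is a smooth closed form satisfying (1) and (2) if and only if $\bar\omega$ is a symplectic structure satisfying (2'); and every smooth closed $2$-form $\omega$ on $\mathcal E$ satisfying (1) and (2) is $\mathrm{pr}^*\bar\omega$ for a unique $2$-form $\bar\omega$ on $\mathrm{Sol}$. -/

import Mathlib

open scoped ContDiff Manifold

noncomputable section

/-- The space of jets of functions `y(x)` with coordinates `(x, y_0, …, y_{k-1})`,
that is the jet space `J^{k-1}(ℝ, ℝ)`. So `J^m(ℝ, ℝ)` is `Jet (m + 1)`. -/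
abbrev Jet (k : ℕ) : Type := ℝ × (Fin k → ℝ)

namespace Jet

/-- The projection of jets that forgets the derivatives of order `≥ k`. -/
def proj {k m : ℕ} (h : k ≤ m) (j : Jet m) : Jet k :=
  (j.1, fun i => j.2 (Fin.castLE h i))

/-- The jet `(x, y_0, …, y_{k-1}, t)`. -/
def extend {k : ℕ} (p : Jet k) (t : ℝ) : Jet (k + 1) :=
  (p.1, Fin.snoc (α := fun _ => ℝ) p.2 t)

end Jet

/-- The partial derivative `∂f/∂y_i`. -/
def partialY {k : ℕ} (f : Jet k → ℝ) (i : Fin k) (p : Jet k) : ℝ :=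
  fderiv ℝ f p (0, Pi.single i 1)

/-- The total derivative `d/dx = ∂/∂x + ∑ y_{i+1} ∂/∂y_i`. -/
def totalDeriv {k : ℕ} (g : Jet k → ℝ) (j : Jet (k + 1)) : ℝ :=
  fderiv ℝ g (Jet.proj (Nat.le_succ k) j) (1, fun i => j.2 i.succ)

/-- The iterated total derivative `d^r/dx^r`. -/
def totalDerivIter {k : ℕ} : (r : ℕ) → (Jet k → ℝ) → (Jet (k + r) → ℝ)
  | 0, g => g
  | r + 1, g => totalDeriv (totalDerivIter r g)

/-- The Euler–Lagrange expression `∑_{k ≤ n} (-1)^k d^k/dx^k (∂f/∂y_k)` of the Lagrangian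
`f(x, y, …, y^{(n)}) dx`, a function on `J^{2n}`. -/
def eulerLagrange {n : ℕ} (f : Jet (n + 1) → ℝ) (j : Jet (2 * n + 1)) : ℝ :=
  ∑ k : Fin (n + 1), (-1 : ℝ) ^ (k : ℕ) *
    totalDerivIter (k : ℕ) (partialY f k)
      (Jet.proj (by have := k.isLt; omega : n + 1 + (k : ℕ) ≤ 2 * n + 1) j)

/-- `f(x, y, …, y^{(n)}) dx` is a smooth Lagrangian on the open set `U ⊆ J^n`, nondegenerate in
the sense that `∂²f/∂y_n²` vanishes nowhere. -/
structure IsNondegenerateLagrangian {n : ℕ} (f : Jet (n + 1) → ℝ) (U : Set (Jet (n + 1))) :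
    Prop where
  isOpen : IsOpen U
  smooth : ContDiffOn ℝ ∞ f U
  nondegenerate : ∀ p ∈ U, partialY (partialY f (Fin.last n)) (Fin.last n) p ≠ 0

/-- Over `U`, the Euler–Lagrange hypersurface `E(L)` in `J^{2n}` is
`y_{2n} = F(x, y_0, …, y_{2n-1})`. Hence `(x, y_0, …, y_{2n-1})` are coordinates on `E(L)`, which
is identified with an open subset of `Jet (2 * n)`. -/
def IsEulerLagrangeEquation {n : ℕ} (f : Jet (n + 1) → ℝ) (U : Set (Jet (n + 1)))
    (F : Jet (2 * n) → ℝ) : Prop :=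
  ∀ j : Jet (2 * n + 1), Jet.proj (by omega : n + 1 ≤ 2 * n + 1) j ∈ U →
    (eulerLagrange f j = 0 ↔ j.2 (Fin.last (2 * n)) = F (Jet.proj (Nat.le_succ _) j))

section Equation

variable {N : ℕ}

/-- The line distribution `S` on the equation `y_N = F(x, y_0, …, y_{N-1})`, in the coordinates
`(x, y_0, …, y_{N-1})`: the tangent vectors that are annihilated by the restrictions to the
equation of the contact forms `θ_i = dy_i - y_{i+1} dx`, `i = 0, …, N - 1`. -/
def solutionLine (F : Jet N → ℝ) (p : Jet N) : Submodule ℝ (Jet N) where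
  carrier := {v | ∀ i : Fin N, v.2 i - (Jet.extend p (F p)).2 i.succ * v.1 = 0}
  add_mem' := by
    intro a b ha hb i
    have h1 := ha i
    have h2 := hb i
    simp only [Prod.snd_add, Prod.fst_add, Pi.add_apply]
    linear_combination h1 + h2
  zero_mem' := by intro i; simp
  smul_mem' := by
    intro c a ha i
    have h1 := ha i
    simp only [Prod.smul_snd, Prod.smul_fst, Pi.smul_apply, smul_eq_mul]
    linear_combination c * h1

/-- The vertical distribution `V^i` of rank `i`: the kernel of the differential of the projection
of the equation to `J^{N-1-i}`, spanned by `∂/∂y_{N-i}, …, ∂/∂y_{N-1}`. -/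
def vertical (N i : ℕ) : Submodule ℝ (Jet N) where
  carrier := {v | v.1 = 0 ∧ ∀ k : Fin N, (k : ℕ) + i < N → v.2 k = 0}
  add_mem' := by
    rintro a b ⟨ha, ha'⟩ ⟨hb, hb'⟩
    refine ⟨by simp [ha, hb], fun k hk => by simp [ha' k hk, hb' k hk]⟩
  zero_mem' := ⟨rfl, fun _ _ => rfl⟩
  smul_mem' := by
    rintro c a ⟨ha, ha'⟩
    exact ⟨by simp [ha], fun k hk => by simp [ha' k hk]⟩

/-- A 2-form (in the coordinates of the equation). -/
abbrev EqForm (N : ℕ) : Type := Jet N → (Jet N) [⋀^Fin 2]→L[ℝ] ℝ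

/-- `α` is a smooth closed 2-form on the open subset `W` of the equation, its kernel is the line
distribution `S`, and it vanishes on `V^i`. -/
structure IsAdaptedForm (F : Jet N → ℝ) (W : TopologicalSpace.Opens (Jet N)) (i : ℕ)
    (α : EqForm N) : Prop where
  smooth : ContDiffOn ℝ ∞ α W
  closed : ∀ p ∈ W, extDeriv α p = 0
  ker_eq : ∀ p ∈ W, ∀ v, (∀ w, α p ![v, w] = 0) ↔ v ∈ solutionLine F p
  vanish : ∀ p ∈ W, ∀ v ∈ vertical N i, ∀ w ∈ vertical N i, α p ![v, w] = 0

/-- Two points of `W` lie on the same solution (the same leaf of `S` in `W`): they are joined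
inside `W` by a curve that is everywhere tangent to `S`. -/
def SameSolution (F : Jet N → ℝ) (W : TopologicalSpace.Opens (Jet N)) (p q : W) : Prop :=
  ∃ (γ : ℝ → Jet N) (a b : ℝ), γ a = p ∧ γ b = q ∧
    ∀ t ∈ Set.uIcc a b, γ t ∈ W ∧ ∃ v ∈ solutionLine F (γ t), HasDerivAt γ v t

/-- The solution space `Sol = W / Fol(S)`, with the quotient topology. -/
def Sol (F : Jet N → ℝ) (W : TopologicalSpace.Opens (Jet N)) : Type :=
  Quot (SameSolution F W)

instance (F : Jet N → ℝ) (W : TopologicalSpace.Opens (Jet N)) : TopologicalSpace (Sol F W) :=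
  inferInstanceAs (TopologicalSpace (Quot (SameSolution F W)))

/-- The projection `pr : W → Sol`. -/
def Sol.mk (F : Jet N → ℝ) (W : TopologicalSpace.Opens (Jet N)) (p : W) : Sol F W :=
  Quot.mk _ p

end Equation

section Forms

variable {d : ℕ} {M : Type*} [TopologicalSpace M] [ChartedSpace (EuclideanSpace ℝ (Fin d)) M]

/-- The expression of a 2-form on a manifold in the chart `e` (its pullback under `e⁻¹`). -/
def formInChart (α : ∀ x : M, (TangentSpace (𝓡 d) x) [⋀^Fin 2]→L[ℝ] ℝ)
    (e : OpenPartialHomeomorph M (EuclideanSpace ℝ (Fin d))) (y : EuclideanSpace ℝ (Fin d)) :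
    (EuclideanSpace ℝ (Fin d)) [⋀^Fin 2]→L[ℝ] ℝ :=
  (α (e.symm y)).compContinuousLinearMap (mfderiv (𝓡 d) (𝓡 d) e.symm y)

/-- A symplectic structure on a manifold: a smooth closed nondegenerate 2-form. -/
structure IsSymplecticForm (α : ∀ x : M, (TangentSpace (𝓡 d) x) [⋀^Fin 2]→L[ℝ] ℝ) : Prop where
  smooth : ∀ e ∈ atlas (EuclideanSpace ℝ (Fin d)) M, ContDiffOn ℝ ∞ (formInChart α e) e.target
  closed : ∀ e ∈ atlas (EuclideanSpace ℝ (Fin d)) M, ∀ y ∈ e.target,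
    extDeriv (formInChart α e) y = 0
  nondegenerate : ∀ x : M, ∀ v, (∀ w, α x ![v, w] = 0) → v = 0

/-- `L` is a Lagrangian subspace for the form `α` on the tangent space at `x`: it is equal to its
`α`-orthogonal complement. -/
def IsLagrangianSubspace {x : M} (α : (TangentSpace (𝓡 d) x) [⋀^Fin 2]→L[ℝ] ℝ)
    (L : Submodule ℝ (TangentSpace (𝓡 d) x)) : Prop :=
  ∀ v, v ∈ L ↔ ∀ w ∈ L, α ![v, w] = 0

end Forms

section SolutionManifold

variable {N d : ℕ} (F : Jet N → ℝ) (W : TopologicalSpace.Opens (Jet N))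
  [ChartedSpace (EuclideanSpace ℝ (Fin d)) (Sol F W)]

variable (d) in
/-- The differential of the projection `pr : W → Sol` at `p`. -/
def solProjDeriv (p : W) : Jet N →L[ℝ] TangentSpace (𝓡 d) (Sol.mk F W p) :=
  mfderiv 𝓘(ℝ, Jet N) (𝓡 d) (Sol.mk F W) p

variable (d) in
/-- The manifold structure on `Sol` is that of the quotient manifold `W / Fol(S)`: the projection
is a smooth submersion. -/
def IsQuotientManifold : Prop :=
  ContMDiff 𝓘(ℝ, Jet N) (𝓡 d) ∞ (Sol.mk F W) ∧
    ∀ p : W, Function.Surjective (solProjDeriv d F W p)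

variable (d) in
/-- The point `Lin^i_Γ(p) = pr_*(V^i_p)` of the linearization of `V^i` along the solution `Γ`
through `p`, a subspace of `T_Γ Sol`. As `p` runs through `Γ` it traces the curve `Lin^i_Γ`. -/
def linearization (i : ℕ) (p : W) : Submodule ℝ (TangentSpace (𝓡 d) (Sol.mk F W p)) :=
  (vertical N i).map (solProjDeriv d F W p).toLinearMap

/-- A 2-form on the manifold of solutions. -/
abbrev SolForm (d : ℕ) (F : Jet N → ℝ) (W : TopologicalSpace.Opens (Jet N))
    [ChartedSpace (EuclideanSpace ℝ (Fin d)) (Sol F W)] : Type :=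
  ∀ Γ : Sol F W, (TangentSpace (𝓡 d) Γ) [⋀^Fin 2]→L[ℝ] ℝ

/-- `η` is a symplectic structure on `Sol` for which all the linearizations `Lin^i_Γ` are curves of
Lagrangian subspaces. -/
def IsAdaptedSymplectic (i : ℕ) (η : SolForm d F W) : Prop :=
  IsSymplecticForm η ∧
    ∀ p : W, IsLagrangianSubspace (η (Sol.mk F W p)) (linearization d F W i p)

/-- `α = pr^* η` on `W`. -/
def IsPullback (α : EqForm N) (η : SolForm d F W) : Prop :=
  ∀ (p : W) (v w : Jet N),
    α p ![v, w] = η (Sol.mk F W p) ![solProjDeriv d F W p v, solProjDeriv d F W p w]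

end SolutionManifold

end

noncomputable section

open scoped Topology

/-! ### Alternating 2-forms and their exterior derivative -/

section TwoForms

/-! Let X be the field with dx(X) = 1 spanning S, and e_k = ∂/∂y_{2n-1-k} (`Jet.back`).

Uniqueness. A closed ω with X in its kernel satisfies L_X ω = 0. Since [X, e_k] = -(e_{k+1} +
dF(e_k) e_0), the coefficients B_{kl} = ω(e_k, e_l) obey `coef_recursion`, which fixes each
antidiagonal k + l = s from the lower ones and one of its entries. Condition (2) supplies a zero
entry for every s ≤ 2n-2, so these antidiagonals vanish; on s = 2n-1 the entries alternate in sign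
with a common nonzero size g; and B_{nn} = 0 on s = 2n gives n X(g) + dF(e_0) g = 0. Hence the ratio
r of the functions g of two such forms is constant along X, ω' - rω obeys the same recursion with a
zero on every antidiagonal, and ω' = rω. Closedness gives dr ∧ ω = 0, so dr = 0 because ω has rank
2n ≥ 4. The carriers are `eq_zero_of_recursion`, `fderiv_coef`, `eq_div_smul` and `exists_eq_smul`.

Existence. Take the differential of the Poincaré–Cartan form f dx + ∑ E_{i+1} θ_i. The momenta
satisfy E_i = ∂f/∂y_i - X(E_{i+1}), and E_0 = 0 is the Euler–Lagrange equation, so the differential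
equals ∑_{i<n} (dE_{i+1} - X(E_{i+1}) dx) ∧ θ_i. All these 1-forms kill X, and V^n kills each θ_i
with i < n. The highest variable of E_{i+1} is y_{2n-1-i}, with coefficient ±∂²f/∂y_n², so the 2n
factors are independent and the kernel is exactly S (`isAdaptedForm_cartanTwoForm`).

Descent. A form with kernel S that is invariant along X is basic, so it comes from a unique form on
`Sol`; local sections carry smoothness and closedness down, and the triangular shape of B makes V^n
project onto Lagrangian subspaces. -/

theorem minSmoothness_two_le_infty : minSmoothness ℝ 2 ≤ (∞ : WithTop ℕ∞) := by
  simpa using WithTop.coe_le_coe.2 (le_top : (2 : ℕ∞) ≤ ⊤)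

variable {E : Type*} [NormedAddCommGroup E] [NormedSpace ℝ E]

/-- The bilinear form underlying an alternating 2-form. -/
def twoFormBilin (α : E [⋀^Fin 2]→L[ℝ] ℝ) : E →ₗ[ℝ] E →ₗ[ℝ] ℝ :=
  LinearMap.mk₂ ℝ (fun v w => α ![v, w])
    (fun a b w => α.toContinuousMultilinearMap.cons_add ![w] a b)
    (fun c a w => α.toContinuousMultilinearMap.cons_smul ![w] c a)
    (fun v a b => by
      have u : ∀ x, Function.update ![v, a] 1 x = ![v, x] := fun x => by
        ext i; fin_cases i <;> rfl
      have h := α.map_update_add ![v, a] 1 a b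
      rwa [u, u, u] at h)
    (fun c v a => by
      have u : ∀ x, Function.update ![v, a] 1 x = ![v, x] := fun x => by
        ext i; fin_cases i <;> rfl
      have h := α.map_update_smul ![v, a] 1 c a
      rwa [u, u] at h)

theorem twoFormBilin_apply (α : E [⋀^Fin 2]→L[ℝ] ℝ) (v w : E) :
    twoFormBilin α v w = α ![v, w] := rfl

theorem twoForm_self (α : E [⋀^Fin 2]→L[ℝ] ℝ) (v : E) : α ![v, v] = 0 :=
  α.map_eq_zero_of_eq ![v, v] (i := 0) (j := 1) rfl (by decide)

theorem twoForm_swap (α : E [⋀^Fin 2]→L[ℝ] ℝ) (v w : E) : α ![v, w] = -α ![w, v] := by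
  have h := twoForm_self α (v + w)
  rw [← twoFormBilin_apply] at h
  simp only [map_add, LinearMap.add_apply, twoFormBilin_apply, twoForm_self] at h
  linarith

theorem twoForm_ext {α η : E [⋀^Fin 2]→L[ℝ] ℝ} (h : ∀ v w, α ![v, w] = η ![v, w]) : α = η := by
  ext v
  have hv : v = ![v 0, v 1] := by ext i; fin_cases i <;> rfl
  rw [hv]
  exact h _ _

/-- The exterior derivative of a 2-form evaluated at a vector field in its kernel. -/
theorem extDeriv_apply_of_ker {α : E → E [⋀^Fin 2]→L[ℝ] ℝ} {X v w : E → E} {p : E}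
    (hα : DifferentiableAt ℝ α p) (hX : DifferentiableAt ℝ X p)
    (hv : DifferentiableAt ℝ v p) (hw : DifferentiableAt ℝ w p)
    (hker : ∀ᶠ q in 𝓝 p, ∀ u, α q ![X q, u] = 0) :
    extDeriv α p ![X p, v p, w p] = fderiv ℝ (fun q => α q ![v q, w q]) p (X p)
      - α p ![VectorField.lieBracket ℝ X v p, w p]
      - α p ![v p, VectorField.lieBracket ℝ X w p] := by
  have h := extDeriv_apply_vectorField (V := ![X, v, w]) hα
    (by intro i; fin_cases i <;> simpa)
  have hV : (fun i => (![X, v, w] : Fin 3 → E → E) i p) = ![X p, v p, w p] := by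
    ext i; fin_cases i <;> rfl
  have r0 : ∀ q, (Fin.removeNth (0 : Fin 3) fun i => (![X, v, w] : Fin 3 → E → E) i q)
      = ![v q, w q] := by
    intro q; ext i; fin_cases i <;> rfl
  have r1 : ∀ q, (Fin.removeNth (1 : Fin 3) fun i => (![X, v, w] : Fin 3 → E → E) i q)
      = ![X q, w q] := by
    intro q; ext i; fin_cases i <;> rfl
  have r2 : ∀ q, (Fin.removeNth (2 : Fin 3) fun i => (![X, v, w] : Fin 3 → E → E) i q)
      = ![X q, v q] := by
    intro q; ext i; fin_cases i <;> rfl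
  -- X stays in the kernel on a neighbourhood, so the terms differentiating α(X, ·) vanish; what
  -- remains is L_X α evaluated on v and w.
  have z1 : fderiv ℝ (fun q => α q ![X q, w q]) p = 0 := by
    rw [Filter.EventuallyEq.fderiv_eq (f := fun _ => (0 : ℝ)) (hker.mono fun q hq => hq _)]
    simp
  have z2 : fderiv ℝ (fun q => α q ![X q, v q]) p = 0 := by
    rw [Filter.EventuallyEq.fderiv_eq (f := fun _ => (0 : ℝ)) (hker.mono fun q hq => hq _)]
    simp
  have k : ∀ u, α p ![X p, u] = 0 := hker.self_of_nhds
  have s00 : (Fin.removeNth (0 : Fin 2) ![v p, w p]) = ![w p] := by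
    ext i; fin_cases i; rfl
  have s10 : (Fin.removeNth (1 : Fin 2) ![v p, w p]) = ![v p] := by
    ext i; fin_cases i; rfl
  have s11 : Fin.removeNth (1 : Fin 2) (Fin.removeNth (1 : Fin 3) ![X p, v p, w p]) = ![X p] := by
    ext i; fin_cases i; rfl
  have i0 : Finset.Ici (0 : Fin 2) = {0, 1} := by decide
  have i1 : Finset.Ici (1 : Fin 2) = {1} := by decide
  rw [hV] at h
  rw [h, Fin.sum_univ_three, Fin.sum_univ_two]
  simp only [r0, r1, r2, z1, z2, i0, i1, Fin.castSucc_zero, Fin.castSucc_one]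
  rw [Finset.sum_pair (by decide), Finset.sum_singleton]
  have e1 : α p ![VectorField.lieBracket ℝ v w p, X p] = 0 := by rw [twoForm_swap, k, neg_zero]
  have e2 := twoForm_swap (α p) (v p) (VectorField.lieBracket ℝ X w p)
  simp [s00, s10, s11, e1, e2]
  ring

theorem extDeriv_const_apply {α : E → E [⋀^Fin 2]→L[ℝ] ℝ} {p : E}
    (hα : DifferentiableAt ℝ α p) (a b c : E) :
    extDeriv α p ![a, b, c] = fderiv ℝ (fun q => α q ![b, c]) p a
      - fderiv ℝ (fun q => α q ![a, c]) p b + fderiv ℝ (fun q => α q ![a, b]) p c := by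
  rw [extDeriv_apply hα, Fin.sum_univ_three]
  have r0 : (Fin.removeNth (0 : Fin 3) ![a, b, c]) = ![b, c] := by
    ext i; fin_cases i <;> rfl
  have r1 : (Fin.removeNth (1 : Fin 3) ![a, b, c]) = ![a, c] := by
    ext i; fin_cases i <;> rfl
  have r2 : (Fin.removeNth (2 : Fin 3) ![a, b, c]) = ![a, b] := by
    ext i; fin_cases i <;> rfl
  simp [r0, r1, r2]
  ring

end TwoForms

/-! ### Coordinate fields and the field spanning the line distribution -/

namespace Jet

variable {N : ℕ}

/-- The coordinate vector field `∂/∂y_{N-1-k}`, and zero for `k ≥ N`. -/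
def back (N k : ℕ) : Jet N := (0, fun i => if (i : ℕ) + k + 1 = N then 1 else 0)

/-- The linear map `(x, y_0, …, y_{N-1}) ↦ (0, y_1, …, y_{N-1}, 0)`. -/
def shift (N : ℕ) : Jet N →L[ℝ] Jet N :=
  ContinuousLinearMap.prod 0 (ContinuousLinearMap.pi fun i =>
    if h : (i : ℕ) + 1 < N then
      (ContinuousLinearMap.proj (⟨i + 1, h⟩ : Fin N)).comp (ContinuousLinearMap.snd ℝ ℝ (Fin N → ℝ))
    else 0)

@[simp] theorem back_fst (k : ℕ) : (back N k).1 = 0 := rfl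

theorem back_snd (k : ℕ) (i : Fin N) : (back N k).2 i = if (i : ℕ) + k + 1 = N then 1 else 0 := rfl

@[simp] theorem shift_fst (p : Jet N) : (shift N p).1 = 0 := rfl

theorem shift_snd (p : Jet N) (i : Fin N) :
    (shift N p).2 i = if h : (i : ℕ) + 1 < N then p.2 ⟨i + 1, h⟩ else 0 := by
  simp only [shift, ContinuousLinearMap.prod_apply, ContinuousLinearMap.pi_apply]
  split_ifs <;> rfl

theorem back_eq_zero {k : ℕ} (h : N ≤ k) : back N k = 0 := by
  ext i
  · rfl
  · rw [back_snd, if_neg (by omega)]; rfl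

theorem shift_back (k : ℕ) : shift N (back N k) = back N (k + 1) := by
  ext i
  · rfl
  · rw [shift_snd, back_snd]
    split_ifs with h1 h2 h2
    · rw [back_snd, if_pos (by simp; omega)]
    · rw [back_snd, if_neg (by simp; omega)]
    · omega
    · rfl

theorem eq_sum_back (v : Jet N) (hv : v.1 = 0) :
    v = ∑ i : Fin N, v.2 i • back N (N - 1 - i) := by
  ext j
  · simp [Prod.fst_sum, hv]
  · rw [Prod.snd_sum, Finset.sum_apply, Finset.sum_eq_single j]
    · rw [Prod.smul_snd, Pi.smul_apply, back_snd, if_pos (by omega)]; simp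
    · intro i _ hij
      have : (i : ℕ) ≠ j := fun h => hij (Fin.ext h)
      rw [Prod.smul_snd, Pi.smul_apply, back_snd, if_neg (by omega)]; simp
    · simp

/-- Two linear maps that agree on the vertical vectors `∂/∂y_i` agree on vectors without
`∂/∂x` component. -/
theorem eq_zero_of_back {G : Type*} [AddCommGroup G] [Module ℝ G] (l : Jet N →ₗ[ℝ] G)
    (h : ∀ k < N, l (back N k) = 0) (v : Jet N) (hv : v.1 = 0) : l v = 0 := by
  rw [eq_sum_back v hv, map_sum]
  refine Finset.sum_eq_zero fun i _ => ?_
  rw [map_smul, h _ (by omega), smul_zero]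

end Jet

section SolField

variable {N : ℕ}

/-- The vector field `∂/∂x + ∑ y_{i+1} ∂/∂y_i + F ∂/∂y_{N-1}`, which spans the line distribution
of the equation `y_N = F`. -/
def solField (F : Jet N → ℝ) (p : Jet N) : Jet N := (1, fun i => (Jet.extend p (F p)).2 i.succ)

theorem solField_fst (F : Jet N → ℝ) (p : Jet N) : (solField F p).1 = 1 := rfl

theorem mem_solutionLine {F : Jet N → ℝ} {p v : Jet N} :
    v ∈ solutionLine F p ↔ v = v.1 • solField F p := by
  constructor
  · intro h
    ext i
    · simp [solField]
    · have := h i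
      simp only [solField, Prod.smul_snd, Pi.smul_apply, smul_eq_mul]
      linarith
  · intro h i
    rw [h]
    simp [solField]
    ring

theorem solField_mem (F : Jet N → ℝ) (p : Jet N) : solField F p ∈ solutionLine F p := by
  rw [mem_solutionLine, solField_fst, one_smul]

theorem extend_snd_succ (p : Jet N) (t : ℝ) (i : Fin N) : (Jet.extend p t).2 i.succ =
    (Jet.shift N p).2 i + t * (Jet.back N 0).2 i := by
  rw [Jet.shift_snd, Jet.back_snd]
  simp only [Jet.extend, Fin.snoc, Fin.val_succ]
  by_cases h : (i : ℕ) + 1 < N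
  · rw [dif_pos h, dif_pos h, if_neg (by omega)]
    simp [Fin.castLT, Fin.succ]
  · rw [dif_neg h, dif_neg h, if_pos (by omega)]
    simp

theorem solField_eq (F : Jet N → ℝ) (p : Jet N) :
    solField F p = (1, 0) + Jet.shift N p + F p • Jet.back N 0 := by
  ext i
  · simp [solField]
  · simp only [solField, extend_snd_succ]
    simp

theorem hasFDerivAt_solField {F : Jet N → ℝ} {p : Jet N} (hF : DifferentiableAt ℝ F p) :
    HasFDerivAt (solField F) (Jet.shift N + (fderiv ℝ F p).smulRight (Jet.back N 0)) p := by
  have h : solField F = fun q => (1, 0) + Jet.shift N q + F q • Jet.back N 0 :=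
    funext (solField_eq F)
  rw [h]
  exact ((Jet.shift N).hasFDerivAt.const_add _).add (hF.hasFDerivAt.smul_const _)

theorem contDiffOn_solField {F : Jet N → ℝ} {s : Set (Jet N)} (hF : ContDiffOn ℝ ∞ F s) :
    ContDiffOn ℝ ∞ (solField F) s := by
  have h : solField F = fun q => (1, 0) + Jet.shift N q + F q • Jet.back N 0 :=
    funext (solField_eq F)
  rw [h]
  exact (contDiffOn_const.add (Jet.shift N).contDiff.contDiffOn).add (hF.smul contDiffOn_const)

/-- Apart from the term `F p • back N 0`, the field is affine in the jet with linear part `shift`.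
Bracketing thus moves ∂/∂y_i to ∂/∂y_{i-1}, up to a multiple of ∂/∂y_{N-1}; the coefficient
recursion rests on this shift. -/
theorem lieBracket_solField_const {F : Jet N → ℝ} {p : Jet N} (hF : DifferentiableAt ℝ F p)
    (k : ℕ) : VectorField.lieBracket ℝ (solField F) (fun _ => Jet.back N k) p =
      -(Jet.back N (k + 1) + fderiv ℝ F p (Jet.back N k) • Jet.back N 0) := by
  rw [VectorField.lieBracket, (hasFDerivAt_solField hF).fderiv]
  simp [Jet.shift_back]

end SolField

/-! ### Coefficient recursion and uniqueness of the adapted form -/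

section Uniqueness

/-- Each step along the antidiagonal flips the sign, so one entry determines all. The coefficient
recursion takes this form once the lower antidiagonals vanish. -/
theorem alternating_antidiagonal {B : ℕ → ℕ → ℝ} {s : ℕ}
    (h : ∀ k l, k + l + 1 = s → B (k + 1) l + B k (l + 1) = 0) :
    ∀ k l, k + l = s → B k l = (-1) ^ k * B 0 s := by
  intro k
  induction k with
  | zero => intro l hl; rw [zero_add] at hl; subst hl; simp
  | succ k ih =>
    intro l hl
    have h1 := h k l (by omega)
    have h2 := ih (l + 1) (by omega)
    rw [pow_succ]
    linear_combination h1 - h2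

/-- Functions that satisfy the recursion of the coefficients of an invariant 2-form, and that have
a zero on each antidiagonal `k + l = s ≤ S`, vanish for `k + l ≤ S`. -/
theorem eq_zero_of_recursion {E : Type*} [NormedAddCommGroup E] [NormedSpace ℝ E]
    {W : Set E} (hW : IsOpen W) {X : E → E} {G : ℕ → E → ℝ} {B : ℕ → ℕ → E → ℝ} {S : ℕ}
    (hrec : ∀ p ∈ W, ∀ k l, fderiv ℝ (B k l) p (X p) =
      -B (k + 1) l p - B k (l + 1) p - G k p * B 0 l p - G l p * B k 0 p)
    (hpin : ∀ s ≤ S, ∃ k l, k + l = s ∧ ∀ p ∈ W, B k l p = 0) :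
    ∀ s ≤ S, ∀ k l, k + l = s → ∀ p ∈ W, B k l p = 0 := by
  intro s
  induction s using Nat.strong_induction_on with
  | _ s ih =>
    intro hs k l hkl p hp
    -- `B k l` has index sum s - 1 and vanishes on the whole open set, so its derivative vanishes
    -- too; the terms with `G` also have index sums below s. Only the two entries on antidiagonal s
    -- survive.
    have key : ∀ k l, k + l + 1 = s → B (k + 1) l p + B k (l + 1) p = 0 := by
      intro k l h
      have hz : fderiv ℝ (B k l) p = 0 := by
        rw [Filter.EventuallyEq.fderiv_eq (f := fun _ => (0 : ℝ))]
        · simp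
        · filter_upwards [hW.mem_nhds hp] with q hq
          exact ih (k + l) (by omega) (by omega) k l rfl q hq
      have h1 := hrec p hp k l
      rw [hz, ih l (by omega) (by omega) 0 l (by omega) p hp,
        ih k (by omega) (by omega) k 0 (by omega) p hp] at h1
      simp only [zero_apply] at h1
      linarith
    have alt := alternating_antidiagonal (B := fun k l => B k l p) key
    obtain ⟨k0, l0, h0, hz⟩ := hpin s hs
    have h1 := alt k0 l0 h0
    have h2 := alt k l hkl
    simp only [hz p hp] at h1
    have h3 : B 0 s p = 0 := by
      rcases mul_eq_zero.1 h1.symm with h | h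
      · exact absurd h (pow_ne_zero _ (by norm_num))
      · exact h
    simp only [h3, mul_zero] at h2
    exact h2

variable {N : ℕ}

/-- The coefficient of the 2-form `α` at the vectors `∂/∂y_{N-1-k}`, `∂/∂y_{N-1-l}`. -/
def coef (α : EqForm N) (k l : ℕ) (p : Jet N) : ℝ := α p ![Jet.back N k, Jet.back N l]

theorem coef_swap (α : EqForm N) (k l : ℕ) (p : Jet N) : coef α k l p = -coef α l k p :=
  twoForm_swap _ _ _

theorem coef_eq_zero_right (α : EqForm N) (k : ℕ) {l : ℕ} (hl : N ≤ l) (p : Jet N) :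
    coef α k l p = 0 := by
  rw [coef, Jet.back_eq_zero hl, ← twoFormBilin_apply, map_zero]

/-- The solution field and the vectors `back` together span: subtracting the right multiple of the
field removes the ∂/∂x component of a vector. -/
theorem twoForm_eq_of_coef {F : Jet N → ℝ} {p : Jet N} {a b : (Jet N) [⋀^Fin 2]→L[ℝ] ℝ}
    (ha : ∀ w, a ![solField F p, w] = 0) (hb : ∀ w, b ![solField F p, w] = 0)
    (h : ∀ k l, a ![Jet.back N k, Jet.back N l] = b ![Jet.back N k, Jet.back N l]) : a = b := by
  have hX : ∀ v w, (a - b) ![v, w] = (a - b) ![v - v.1 • solField F p, w] := by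
    intro v w
    rw [← twoFormBilin_apply, ← twoFormBilin_apply, map_sub, map_smul]
    have : twoFormBilin (a - b) (solField F p) w = 0 := by
      rw [twoFormBilin_apply, ContinuousAlternatingMap.sub_apply, ha, hb, sub_zero]
    simp [this]
  have hfst : ∀ v : Jet N, (v - v.1 • solField F p).1 = 0 := by
    intro v; simp [solField_fst]
  have h1 : ∀ k, ∀ w : Jet N, w.1 = 0 → (a - b) ![Jet.back N k, w] = 0 := by
    intro k w hw
    refine Jet.eq_zero_of_back (twoFormBilin (a - b) (Jet.back N k)) (fun l _ => ?_) w hw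
    rw [twoFormBilin_apply, ContinuousAlternatingMap.sub_apply, h, sub_self]
  have h2 : ∀ v w : Jet N, v.1 = 0 → w.1 = 0 → (a - b) ![v, w] = 0 := by
    intro v w hv hw
    refine Jet.eq_zero_of_back ((twoFormBilin (a - b)).flip w) (fun l _ => ?_) v hv
    exact h1 l w hw
  rw [← sub_eq_zero]
  refine twoForm_ext fun v w => ?_
  rw [hX, twoForm_swap, hX, h2 _ _ (hfst _) (hfst _), neg_zero]
  rfl

namespace IsAdaptedForm

variable {F : Jet N → ℝ} {W : TopologicalSpace.Opens (Jet N)} {n : ℕ} {α : EqForm N}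

theorem differentiableAt {i : ℕ} (hα : IsAdaptedForm F W i α) {p : Jet N} (hp : p ∈ W) :
    DifferentiableAt ℝ α p :=
  (hα.smooth.contDiffAt (W.isOpen.mem_nhds hp)).differentiableAt (by simp)

theorem solField_apply {i : ℕ} (hα : IsAdaptedForm F W i α) {p : Jet N} (hp : p ∈ W)
    (w : Jet N) : α p ![solField F p, w] = 0 :=
  (hα.ker_eq p hp _).2 (solField_mem F p) w

theorem eventually_solField_apply {i : ℕ} (hα : IsAdaptedForm F W i α) {p : Jet N} (hp : p ∈ W) :
    ∀ᶠ q in 𝓝 p, ∀ u, α q ![solField F q, u] = 0 := by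
  filter_upwards [W.isOpen.mem_nhds hp] with q hq using hα.solField_apply hq

theorem differentiableAt_coef {i : ℕ} (hα : IsAdaptedForm F W i α) {p : Jet N} (hp : p ∈ W)
    (k l : ℕ) : DifferentiableAt ℝ (coef α k l) p :=
  (hα.differentiableAt hp).continuousAlternatingMap_apply_const _

/-- This is L_X α = 0 on constant vertical fields, with the brackets from
`lieBracket_solField_const`. -/
theorem coef_recursion {i : ℕ} (hα : IsAdaptedForm F W i α) {p : Jet N} (hp : p ∈ W)
    (hF : DifferentiableAt ℝ F p) (k l : ℕ) :
    fderiv ℝ (coef α k l) p (solField F p) = -coef α (k + 1) l p - coef α k (l + 1) p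
      - fderiv ℝ F p (Jet.back N k) * coef α 0 l p - fderiv ℝ F p (Jet.back N l) * coef α k 0 p := by
  have h := extDeriv_apply_of_ker (hα.differentiableAt hp) (hasFDerivAt_solField hF).differentiableAt
    (differentiableAt_const (Jet.back N k)) (differentiableAt_const (Jet.back N l))
    (hα.eventually_solField_apply hp)
  rw [hα.closed p hp, lieBracket_solField_const hF, lieBracket_solField_const hF] at h
  simp only [← twoFormBilin_apply, map_neg, map_add, map_smul,
    LinearMap.neg_apply, LinearMap.add_apply, LinearMap.smul_apply, smul_eq_mul] at h
  change (0 : ℝ) = fderiv ℝ (coef α k l) p (solField F p) - _ - _ at h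
  simp only [twoFormBilin_apply] at h
  simp only [coef] at h ⊢
  linear_combination -h

end IsAdaptedForm

namespace IsAdaptedForm

variable {n : ℕ} {F : Jet (2 * n) → ℝ} {W : TopologicalSpace.Opens (Jet (2 * n))}
  {α : EqForm (2 * n)}

theorem coef_eq_zero_of_lt (hα : IsAdaptedForm F W n α) {p : Jet (2 * n)} (hp : p ∈ W) {k l : ℕ}
    (hk : k < n) (hl : l < n) : coef α k l p = 0 := by
  have hv : ∀ k < n, Jet.back (2 * n) k ∈ vertical (2 * n) n := fun k hk =>
    ⟨rfl, fun i hi => by rw [Jet.back_snd, if_neg (by omega)]⟩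
  exact hα.vanish p hp _ (hv k hk) _ (hv l hl)

/-- The middle of the antidiagonal works: for s ≤ 2n - 2 both halves of s are at most n - 1, so both
vectors lie in V^n. -/
theorem exists_coef_eq_zero (hα : IsAdaptedForm F W n α) {s : ℕ} (hs : s + 1 < 2 * n) :
    ∃ k l, k + l = s ∧ ∀ p ∈ W, coef α k l p = 0 :=
  ⟨s / 2, s - s / 2, by omega, fun _ hp => hα.coef_eq_zero_of_lt hp (by omega) (by omega)⟩

variable (hF : ∀ p ∈ W, DifferentiableAt ℝ F p)
include hF

theorem coef_eq_zero (hα : IsAdaptedForm F W n α) {p : Jet (2 * n)} (hp : p ∈ W) {k l : ℕ}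
    (hkl : k + l + 1 < 2 * n) : coef α k l p = 0 :=
  eq_zero_of_recursion W.isOpen (S := k + l)
    (fun _ hp k l => hα.coef_recursion hp (hF _ hp) k l)
    (fun s hs => hα.exists_coef_eq_zero (by omega)) (k + l) le_rfl k l rfl p hp

/-- Everything with k + l ≤ 2n - 2 vanishes, so the recursion at k + l = 2n - 2 reduces to
alternation on the next antidiagonal, leaving one free function. -/
theorem coef_middle (hα : IsAdaptedForm F W n α) {p : Jet (2 * n)} (hp : p ∈ W) {k l : ℕ}
    (hkl : k + l + 1 = 2 * n) : coef α k l p = (-1) ^ k * coef α 0 (2 * n - 1) p := by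
  refine alternating_antidiagonal (B := fun k l => coef α k l p) (fun k l h => ?_) k l (by omega)
  have hz : fderiv ℝ (coef α k l) p = 0 := by
    rw [Filter.EventuallyEq.fderiv_eq (f := fun _ => (0 : ℝ))]
    · simp
    · filter_upwards [W.isOpen.mem_nhds hp] with q hq
      exact hα.coef_eq_zero hF hq (by omega)
  have h1 := hα.coef_recursion hp (hF p hp) k l
  rw [hz, hα.coef_eq_zero hF hp (by omega : 0 + l + 1 < 2 * n),
    hα.coef_eq_zero hF hp (k := k) (l := 0) (by omega)] at h1
  simp only [zero_apply] at h1
  linarith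

/-- Otherwise ∂/∂y_{2n-1} would pair to zero with everything and lie in the kernel, whose nonzero
vectors have a nonzero ∂/∂x component. -/
theorem coef_ne_zero (hα : IsAdaptedForm F W n α) (hn : 0 < n) {p : Jet (2 * n)} (hp : p ∈ W) :
    coef α 0 (2 * n - 1) p ≠ 0 := by
  intro h0
  have h : ∀ w, α p ![Jet.back (2 * n) 0, w] = 0 := by
    intro w
    have e : w = w.1 • solField F p + (w - w.1 • solField F p) := by abel
    have hX : α p ![Jet.back (2 * n) 0, solField F p] = 0 := by
      rw [twoForm_swap, hα.solField_apply hp, neg_zero]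
    rw [e, ← twoFormBilin_apply, map_add, map_smul, twoFormBilin_apply, hX, smul_zero, zero_add]
    refine Jet.eq_zero_of_back _ (fun k hk => ?_) _ (by simp [solField_fst])
    rcases Nat.lt_or_ge (k + 1) (2 * n) with h | h
    · exact hα.coef_eq_zero hF hp (by omega)
    · have : k = 2 * n - 1 := by omega
      subst this
      exact h0
  have h1 := mem_solutionLine.1 ((hα.ker_eq p hp _).1 h)
  rw [Jet.back_fst, zero_smul] at h1
  have h2 := congrArg (fun v : Jet (2 * n) => v.2 ⟨2 * n - 1, by omega⟩) h1
  simp only [Jet.back_snd] at h2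
  rw [if_pos (by omega)] at h2
  exact one_ne_zero h2

/-- The recursion at k + l = 2n - 1 computes the antidiagonal k + l = 2n from its entry (0, 2n),
which is zero because `back (2 * n) (2 * n)` is. Walking to the entry (n, n), zero by antisymmetry,
yields the equation. -/
theorem fderiv_coef (hα : IsAdaptedForm F W n α) (hn : 0 < n) {p : Jet (2 * n)} (hp : p ∈ W) :
    n * fderiv ℝ (coef α 0 (2 * n - 1)) p (solField F p) +
      fderiv ℝ F p (Jet.back (2 * n) 0) * coef α 0 (2 * n - 1) p = 0 := by
  have hd : ∀ k l, k + l + 1 = 2 * n → fderiv ℝ (coef α k l) p (solField F p) =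
      (-1) ^ k * fderiv ℝ (coef α 0 (2 * n - 1)) p (solField F p) := by
    intro k l hkl
    rw [Filter.EventuallyEq.fderiv_eq (f := fun q => (-1) ^ k * coef α 0 (2 * n - 1) q)]
    · rw [fderiv_const_mul (hα.differentiableAt_coef hp _ _)]
      simp
    · filter_upwards [W.isOpen.mem_nhds hp] with q hq
      exact hα.coef_middle hF hq hkl
  -- Every step adds one derivative along X, whence the factor k + 1. The dF term enters only in the
  -- first step; later it multiplies coefficients from vanishing antidiagonals.
  have key : ∀ k l, k + 1 + l = 2 * n → 0 < l → coef α (k + 1) l p = (-1) ^ (k + 1) *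
      ((k + 1 : ℕ) * fderiv ℝ (coef α 0 (2 * n - 1)) p (solField F p) +
        fderiv ℝ F p (Jet.back (2 * n) 0) * coef α 0 (2 * n - 1) p) := by
    intro k
    induction k with
    | zero =>
      intro l hl _
      obtain rfl : l = 2 * n - 1 := by omega
      have h1 := hα.coef_recursion hp (hF p hp) 0 (2 * n - 1)
      rw [coef_eq_zero_right α 0 (l := 2 * n - 1 + 1) (by omega),
        hα.coef_eq_zero_of_lt hp hn hn] at h1
      push_cast
      linear_combination h1
    | succ k ih =>
      intro l hl hl0
      have h1 := hα.coef_recursion hp (hF p hp) (k + 1) l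
      rw [hα.coef_eq_zero hF hp (by omega : 0 + l + 1 < 2 * n),
        hα.coef_eq_zero hF hp (k := k + 1) (l := 0) (by omega), ih (l + 1) (by omega) (by omega),
        hd (k + 1) l (by omega)] at h1
      push_cast at h1 ⊢
      rw [pow_succ (-1 : ℝ) (k + 1)]
      linear_combination h1
  obtain ⟨m, rfl⟩ : ∃ m, n = m + 1 := ⟨n - 1, by omega⟩
  have h1 := key m (m + 1) (by omega) (by omega)
  have h2 : coef α (m + 1) (m + 1) p = 0 := by
    have := coef_swap α (m + 1) (m + 1) p
    linarith
  rw [h2] at h1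
  rcases mul_eq_zero.1 h1.symm with h | h
  · exact absurd h (pow_ne_zero _ (by norm_num))
  · exact h

theorem differentiableAt_div {α' : EqForm (2 * n)} (hα : IsAdaptedForm F W n α)
    (hα' : IsAdaptedForm F W n α') (hn : 0 < n) {p : Jet (2 * n)} (hp : p ∈ W) :
    DifferentiableAt ℝ (fun q => coef α' 0 (2 * n - 1) q / coef α 0 (2 * n - 1) q) p := by
  simp only [div_eq_mul_inv]
  exact (hα'.differentiableAt_coef hp _ _).mul
    ((hα.differentiableAt_coef hp _ _).inv (hα.coef_ne_zero hF hn hp))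

/-- Two adapted forms are proportional at each point. -/
theorem eq_div_smul {α' : EqForm (2 * n)} (hα : IsAdaptedForm F W n α)
    (hα' : IsAdaptedForm F W n α') (hn : 0 < n) {p : Jet (2 * n)} (hp : p ∈ W) :
    α' p = (coef α' 0 (2 * n - 1) p / coef α 0 (2 * n - 1) p) • α p := by
  set g : Jet (2 * n) → ℝ := fun q => coef α' 0 (2 * n - 1) q / coef α 0 (2 * n - 1) q with hg
  have hgd : ∀ q ∈ W, DifferentiableAt ℝ g q := fun q hq =>
    hα.differentiableAt_div hF hα' hn hq
  -- Both coefficients solve the same linear equation along X, namely `fderiv_coef`, so their ratio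
  -- is constant along X.
  have hXg : ∀ q ∈ W, fderiv ℝ g q (solField F q) = 0 := by
    intro q hq
    have h1 := hα.fderiv_coef hF hn hq
    have h2 := hα'.fderiv_coef hF hn hq
    have h3 := hα.coef_ne_zero hF hn hq
    have hmul : ∀ r ∈ W, coef α' 0 (2 * n - 1) r = g r * coef α 0 (2 * n - 1) r := fun r hr =>
      (div_mul_cancel₀ _ (hα.coef_ne_zero hF hn hr)).symm
    rw [Filter.EventuallyEq.fderiv_eq (f := fun r => g r * coef α 0 (2 * n - 1) r)
      (by filter_upwards [W.isOpen.mem_nhds hq] with r hr using hmul r hr),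
      fderiv_fun_mul (hgd q hq) (hα.differentiableAt_coef hq _ _), hmul q hq] at h2
    simp only [smul_apply, add_apply, smul_eq_mul] at h2
    have hn' : (n : ℝ) * coef α 0 (2 * n - 1) q ≠ 0 := mul_ne_zero (by positivity) h3
    refine mul_left_cancel₀ hn' ?_
    linear_combination h2 - g q * h1
  -- As g is constant along X, the coefficients of α' - g α obey the same recursion.
  have key : ∀ k l, coef α' k l p - g p * coef α k l p = 0 := by
    intro k l
    refine eq_zero_of_recursion W.isOpen (S := k + l) (X := solField F)
      (G := fun k q => fderiv ℝ F q (Jet.back (2 * n) k))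
      (B := fun k l q => coef α' k l q - g q * coef α k l q) (fun q hq k l => ?_) (fun s _ => ?_)
      (k + l) le_rfl k l rfl p hp
    · have hd := ((hα'.differentiableAt_coef hq k l).hasFDerivAt).fun_sub
        ((hgd q hq).hasFDerivAt.fun_mul (hα.differentiableAt_coef hq k l).hasFDerivAt)
      rw [hd.fderiv]
      simp only [smul_apply, sub_apply, add_apply, smul_eq_mul, hXg q hq, hα.coef_recursion hq (hF q hq),
        hα'.coef_recursion hq (hF q hq)]
      ring
    -- The required zero on antidiagonal s comes from V^n if s ≤ 2n - 2, from the choice of g if s =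
    -- 2n - 1, and from the vanishing of `back (2 * n) s` if s ≥ 2n.
    · rcases Nat.lt_or_ge (s + 1) (2 * n) with h | h
      · refine ⟨s / 2, s - s / 2, by omega, fun q hq => ?_⟩
        rw [hα.coef_eq_zero_of_lt hq (by omega) (by omega),
          hα'.coef_eq_zero_of_lt hq (by omega) (by omega)]
        simp
      · refine ⟨0, s, by omega, fun q hq => ?_⟩
        rcases h.eq_or_lt with h | h
        · obtain rfl : s = 2 * n - 1 := by omega
          simp only [hg]
          rw [div_mul_cancel₀ _ (hα.coef_ne_zero hF hn hq), sub_self]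
        · rw [coef_eq_zero_right α' 0 (by omega), coef_eq_zero_right α 0 (by omega)]
          simp
  refine twoForm_eq_of_coef (F := F) (hα'.solField_apply hp) (fun w => ?_) (fun k l => ?_)
  · rw [ContinuousAlternatingMap.smul_apply, hα.solField_apply hp, smul_zero]
  · rw [ContinuousAlternatingMap.smul_apply, smul_eq_mul]
    exact sub_eq_zero.1 (key k l)

/-- Two adapted forms differ by a nonzero constant factor. -/
theorem exists_eq_smul {α' : EqForm (2 * n)} (hα : IsAdaptedForm F W n α)
    (hα' : IsAdaptedForm F W n α') (hn : 2 ≤ n) (hW : IsConnected (W : Set (Jet (2 * n)))) :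
    ∃ c : ℝ, c ≠ 0 ∧ ∀ p ∈ W, α' p = c • α p := by
  set g : Jet (2 * n) → ℝ := fun q => coef α' 0 (2 * n - 1) q / coef α 0 (2 * n - 1) q with hg
  have hn0 : 0 < n := by omega
  have hgα : ∀ q ∈ W, α' q = g q • α q := fun q hq => hα.eq_div_smul hF hα' hn0 hq
  have hgd : ∀ q ∈ W, DifferentiableAt ℝ g q := fun q hq =>
    hα.differentiableAt_div hF hα' hn0 hq
  have hdg : ∀ p ∈ W, fderiv ℝ g p = 0 := by
    intro p hp
    -- dg ∧ α = 0, because α and g α are both closed.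
    have wedge : ∀ a b c, fderiv ℝ g p a * α p ![b, c] - fderiv ℝ g p b * α p ![a, c]
        + fderiv ℝ g p c * α p ![a, b] = 0 := by
      intro a b c
      have hd : ∀ u v w, fderiv ℝ (fun q => α' q ![v, w]) p u =
          g p * fderiv ℝ (fun q => α q ![v, w]) p u + fderiv ℝ g p u * α p ![v, w] := by
        intro u v w
        rw [Filter.EventuallyEq.fderiv_eq (f := fun q => g q * α q ![v, w])]
        · rw [fderiv_fun_mul (hgd p hp)
            ((hα.differentiableAt hp).continuousAlternatingMap_apply_const _)]
          simp
          ring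
        · filter_upwards [W.isOpen.mem_nhds hp] with q hq
          rw [hgα q hq]
          simp
      have h1 := extDeriv_const_apply (hα.differentiableAt hp) a b c
      have h2 := extDeriv_const_apply (hα'.differentiableAt hp) a b c
      rw [hα.closed p hp] at h1
      rw [hα'.closed p hp, hd, hd, hd] at h2
      change (0 : ℝ) = _ at h1
      change (0 : ℝ) = _ at h2
      linear_combination g p * h1 - h2
    have wb : ∀ k l m, fderiv ℝ g p (Jet.back _ k) * coef α l m p
        - fderiv ℝ g p (Jet.back _ l) * coef α k m p
        + fderiv ℝ g p (Jet.back _ m) * coef α k l p = 0 := fun k l m => wedge _ _ _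
    have hne := hα.coef_ne_zero hF hn0 hp
    have hz : ∀ k l : ℕ, k + l + 1 < 2 * n → coef α k l p = 0 := fun _ _ h =>
      hα.coef_eq_zero hF hp h
    have hne1 : coef α 1 (2 * n - 2) p ≠ 0 := by
      rw [hα.coef_middle hF hp (by omega)]
      simpa using hne
    -- Here n ≥ 2 matters: it makes the coefficient (0, 1) vanish, so only the pair (1, 2n - 2)
    -- contributes. The other directions are isolated by similar triples.
    have d0 : fderiv ℝ g p (Jet.back _ 0) = 0 := by
      have h := wb 0 1 (2 * n - 2)
      rw [hz 0 (2 * n - 2) (by omega), hz 0 1 (by omega)] at h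
      simpa [hne1] using h
    have d1 : ∀ k, k + 1 < 2 * n → fderiv ℝ g p (Jet.back _ k) = 0 := by
      intro k hk
      have h := wb k 0 (2 * n - 1)
      rw [d0, hz k 0 (by omega)] at h
      simpa [hne] using h
    have d2 : fderiv ℝ g p (Jet.back _ (2 * n - 1)) = 0 := by
      have h := wb (2 * n - 1) 1 (2 * n - 2)
      rw [d1 1 (by omega), d1 (2 * n - 2) (by omega)] at h
      simpa [hne1] using h
    have dX : fderiv ℝ g p (solField F p) = 0 := by
      have h := wedge (solField F p) (Jet.back _ 0) (Jet.back _ (2 * n - 1))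
      rw [hα.solField_apply hp, hα.solField_apply hp] at h
      simpa [show α p ![Jet.back _ 0, Jet.back _ (2 * n - 1)] ≠ 0 from hne] using h
    refine ContinuousLinearMap.ext fun v => ?_
    have e : v = v.1 • solField F p + (v - v.1 • solField F p) := by abel
    rw [e, map_add, map_smul, dX, smul_zero, zero_add]
    refine Jet.eq_zero_of_back (fderiv ℝ g p).toLinearMap (fun k hk => ?_) _
      (by simp [solField_fst])
    rcases Nat.lt_or_ge (k + 1) (2 * n) with h | h
    · exact d1 k h
    · obtain rfl : k = 2 * n - 1 := by omega
      exact d2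
  obtain ⟨c, hc⟩ := W.isOpen.exists_is_const_of_fderiv_eq_zero hW.isPreconnected
    (fun q hq => (hgd q hq).differentiableWithinAt) hdg
  refine ⟨c, ?_, fun p hp => by rw [hgα p hp, hc p hp]⟩
  obtain ⟨p, hp⟩ := hW.nonempty
  rw [← hc p hp]
  exact div_ne_zero (hα'.coef_ne_zero hF hn0 hp) (hα.coef_ne_zero hF hn0 hp)

omit hF in
theorem const_smul (hα : IsAdaptedForm F W n α) {α' : EqForm (2 * n)} {c : ℝ} (hc : c ≠ 0)
    (h : ∀ p ∈ W, α' p = c • α p) : IsAdaptedForm F W n α' where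
  smooth := (hα.smooth.const_smul c).congr h
  closed p hp := by
    have : α' =ᶠ[𝓝 p] c • α := by
      filter_upwards [W.isOpen.mem_nhds hp] with q hq using h q hq
    rw [this.extDeriv_eq, extDeriv_smul, hα.closed p hp, smul_zero]
  ker_eq p hp v := by
    rw [← hα.ker_eq p hp v, h p hp]
    simp [hc]
  vanish p hp v hv w hw := by
    rw [h p hp, ContinuousAlternatingMap.smul_apply, hα.vanish p hp v hv w hw, smul_zero]

/-- The pairing of ∂/∂y_j with `back (2 * n) l` is zero for j > l and nonzero for j = l, a
triangular system that kills y_0, …, y_{n-1} successively. So V^n contains every vertical vector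
orthogonal to it, the maximality behind the Lagrangian property. -/
theorem snd_eq_zero_of_vertical (hα : IsAdaptedForm F W n α) (hn : 0 < n) {p : Jet (2 * n)}
    (hp : p ∈ W) {v : Jet (2 * n)} (hv : v.1 = 0)
    (h : ∀ l < n, α p ![v, Jet.back (2 * n) l] = 0) :
    ∀ (i : ℕ) (hi : i < n), v.2 ⟨i, by omega⟩ = 0 := by
  intro i
  induction i using Nat.strong_induction_on with
  | _ i ih =>
    intro hi
    have h1 := h i hi
    rw [Jet.eq_sum_back v hv, ← twoFormBilin_apply, map_sum, LinearMap.sum_apply,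
      Finset.sum_eq_single ⟨i, by omega⟩] at h1
    · rw [map_smul, LinearMap.smul_apply, smul_eq_mul, twoFormBilin_apply] at h1
      refine (mul_eq_zero.1 h1).resolve_right ?_
      change coef α (2 * n - 1 - i) i p ≠ 0
      rw [hα.coef_middle hF hp (by omega)]
      exact mul_ne_zero (pow_ne_zero _ (by norm_num)) (hα.coef_ne_zero hF hn hp)
    · intro j _ hji
      rw [map_smul, LinearMap.smul_apply, smul_eq_mul, twoFormBilin_apply]
      rcases lt_trichotomy (j : ℕ) i with hj | hj | hj
      · rw [ih j hj (by omega), zero_mul]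
      · exact absurd (Fin.ext hj) hji
      · refine mul_eq_zero_of_right _ ?_
        exact hα.coef_eq_zero hF hp (by omega)
    · simp

end IsAdaptedForm

end Uniqueness

/-! ### Total derivatives and smoothness of the solved Euler–Lagrange equation -/

section EulerLagrange

namespace Jet

/-- The projection of jets as a continuous linear map. -/
def projL {k m : ℕ} (h : k ≤ m) : Jet m →L[ℝ] Jet k :=
  ContinuousLinearMap.prod (ContinuousLinearMap.fst ℝ ℝ (Fin m → ℝ)) (ContinuousLinearMap.pi fun i =>
    (ContinuousLinearMap.proj (Fin.castLE h i)).comp (ContinuousLinearMap.snd ℝ ℝ (Fin m → ℝ)))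

theorem projL_apply {k m : ℕ} (h : k ≤ m) (j : Jet m) : projL h j = proj h j := rfl

theorem proj_extend {k m : ℕ} (h : k ≤ m) (p : Jet m) (t : ℝ) :
    proj (h.trans (Nat.le_succ m)) (extend p t) = proj h p := by
  ext i
  · rfl
  · have hi : (i : ℕ) < m := by omega
    simp [proj, extend, Fin.snoc, hi]
    rfl

theorem contDiff_extend {m : ℕ} (t : ℝ) : ContDiff ℝ ∞ fun p : Jet m => extend p t := by
  refine contDiff_fst.prodMk (contDiff_pi.2 fun i => ?_)
  refine Fin.lastCases ?_ (fun i => ?_) i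
  · simpa [Fin.snoc_last] using contDiff_const
  · simp only [Fin.snoc_castSucc]
    exact (contDiff_apply ℝ ℝ i).comp contDiff_snd

theorem single_last (k : ℕ) : ((0, Pi.single (Fin.last k) 1) : Jet (k + 1)) = back (k + 1) 0 := by
  ext i
  · rfl
  · change (Pi.single (Fin.last k) (1 : ℝ) : Fin (k + 1) → ℝ) i = _
    rw [back_snd, Pi.single_apply]
    congr 1
    simp [Fin.ext_iff]

theorem projL_back {k m : ℕ} (h : k ≤ m) (hm : m = k) : projL h (back m 0) = back k 0 := by
  subst hm; rfl

theorem projL_back_of_lt {k m l : ℕ} (h : k ≤ m) (hl : k + l < m) : projL h (back m l) = 0 := by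
  ext i
  · rfl
  · change (back m l).2 (Fin.castLE h i) = 0
    rw [back_snd, if_neg (by simp; omega)]

end Jet

theorem totalDeriv_extend {k N : ℕ} (g : Jet k → ℝ) (h : k ≤ N) (p : Jet N) (t : ℝ) :
    totalDeriv g (Jet.proj (Nat.succ_le_succ h) (Jet.extend p t)) =
      fderiv ℝ g (Jet.proj h p) (Jet.projL h (solField (fun _ => t) p)) := by
  have e : Jet.proj (Nat.le_succ k) (Jet.proj (Nat.succ_le_succ h) (Jet.extend p t)) =
      Jet.proj h p := Jet.proj_extend h p t
  rw [totalDeriv, e]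
  rfl

theorem contDiffOn_totalDeriv {k : ℕ} {g : Jet k → ℝ} {V : Set (Jet k)} (hV : IsOpen V)
    (hg : ContDiffOn ℝ ∞ g V) :
    ContDiffOn ℝ ∞ (totalDeriv g) (Jet.proj (Nat.le_succ k) ⁻¹' V) := by
  have h1 : ContDiffOn ℝ ∞ (fderiv ℝ g) V := hg.fderiv_of_isOpen hV (by simp)
  have h2 := h1.comp (Jet.projL (Nat.le_succ k)).contDiff.contDiffOn
    (Set.mapsTo_preimage (Jet.projL (Nat.le_succ k)) V)
  refine h2.clm_apply (ContDiff.contDiffOn (contDiff_const.prodMk (contDiff_pi.2 fun i => ?_)))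
  exact (contDiff_apply ℝ ℝ i.succ).comp contDiff_snd

theorem contDiffOn_totalDerivIter {k : ℕ} {g : Jet k → ℝ} {V : Set (Jet k)} (hV : IsOpen V)
    (hg : ContDiffOn ℝ ∞ g V) (r : ℕ) :
    ContDiffOn ℝ ∞ (totalDerivIter r g) (Jet.proj (Nat.le_add_right k r) ⁻¹' V) := by
  induction r with
  | zero => exact hg
  | succ r ih => exact contDiffOn_totalDeriv (hV.preimage (Jet.projL _).continuous) ih

/-- The top variable y_k enters the total derivative only through the last component of the
direction (1, y_1, …, y_k), hence affinely. -/
theorem fderiv_totalDeriv_back {k : ℕ} {g : Jet k → ℝ} {V : Set (Jet k)} (hV : IsOpen V)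
    (hg : ContDiffOn ℝ ∞ g V) {j : Jet (k + 1)} (hj : Jet.proj (Nat.le_succ k) j ∈ V) :
    fderiv ℝ (totalDeriv g) j (Jet.back (k + 1) 0) =
      fderiv ℝ g (Jet.proj (Nat.le_succ k) j) (Jet.back k 0) := by
  have hd : DifferentiableAt ℝ (totalDeriv g) j :=
    ((contDiffOn_totalDeriv hV hg).contDiffAt
      ((hV.preimage (Jet.projL _).continuous).mem_nhds hj)).differentiableAt (by simp)
  rw [← hd.lineDeriv_eq_fderiv, lineDeriv]
  have key : ∀ t : ℝ, totalDeriv g (j + t • Jet.back (k + 1) 0) = totalDeriv g j +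
      t * fderiv ℝ g (Jet.proj (Nat.le_succ k) j) (Jet.back k 0) := by
    intro t
    have hp : Jet.proj (Nat.le_succ k) (j + t • Jet.back (k + 1) 0) =
        Jet.proj (Nat.le_succ k) j := by
      rw [← Jet.projL_apply, map_add, map_smul, Jet.projL_back_of_lt _ (by omega), smul_zero,
        add_zero, Jet.projL_apply]
    have hv : ((1, fun i => (j + t • Jet.back (k + 1) 0).2 i.succ) : Jet k) =
        (1, fun i => j.2 i.succ) + t • Jet.back k 0 := by
      ext i
      · simp
      · simp [Jet.back_snd]
    rw [totalDeriv, totalDeriv, hp, hv, map_add, map_smul, smul_eq_mul]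
  simp only [key]
  simp

theorem fderiv_totalDerivIter_back {k : ℕ} {g : Jet k → ℝ} {V : Set (Jet k)} (hV : IsOpen V)
    (hg : ContDiffOn ℝ ∞ g V) (r : ℕ) {j : Jet (k + r)}
    (hj : Jet.proj (Nat.le_add_right k r) j ∈ V) :
    fderiv ℝ (totalDerivIter r g) j (Jet.back (k + r) 0) =
      fderiv ℝ g (Jet.proj (Nat.le_add_right k r) j) (Jet.back k 0) := by
  induction r with
  | zero => rfl
  | succ r ih =>
    exact (fderiv_totalDeriv_back (hV.preimage (Jet.projL _).continuous)
      (contDiffOn_totalDerivIter hV hg r) hj).trans (ih hj)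

theorem contDiffOn_partialY {k : ℕ} {g : Jet k → ℝ} {V : Set (Jet k)} (hV : IsOpen V)
    (hg : ContDiffOn ℝ ∞ g V) (i : Fin k) : ContDiffOn ℝ ∞ (partialY g i) V :=
  (hg.fderiv_of_isOpen hV (by simp)).clm_apply contDiffOn_const

variable {n : ℕ} {f : Jet (n + 1) → ℝ} {U : Set (Jet (n + 1))}

theorem contDiffOn_eulerLagrange (hf : IsNondegenerateLagrangian f U) :
    ContDiffOn ℝ ∞ (eulerLagrange f)
      (Jet.proj (by omega : n + 1 ≤ 2 * n + 1) ⁻¹' U) := by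
  unfold eulerLagrange
  refine ContDiffOn.sum fun k _ => contDiffOn_const.mul ?_
  exact (contDiffOn_totalDerivIter hf.isOpen (contDiffOn_partialY hf.isOpen hf.smooth k) k).comp
    (Jet.projL _).contDiff.contDiffOn fun _ h => h

/-- Only the summand k = n reaches order 2n. It is affine in y_{2n}, and its slope passes unchanged
through the total derivatives. -/
theorem eulerLagrange_extend (hf : IsNondegenerateLagrangian f U) (hn : 0 < n) {p : Jet (2 * n)}
    (hp : Jet.proj (by omega : n + 1 ≤ 2 * n) p ∈ U) (t : ℝ) :
    eulerLagrange f (Jet.extend p t) = eulerLagrange f (Jet.extend p 0) +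
      t * ((-1) ^ n * partialY (partialY f (Fin.last n)) (Fin.last n) (Jet.proj (by omega) p)) := by
  unfold eulerLagrange
  rw [Fin.sum_univ_castSucc, Fin.sum_univ_castSucc]
  refine (congrArg₂ (· + ·) ?_ ?_).trans (add_assoc _ _ _).symm
  · refine Finset.sum_congr rfl fun k _ => ?_
    have h : n + 1 + (k : ℕ) ≤ 2 * n := by omega
    congr 2
    exact (Jet.proj_extend h p t).trans (Jet.proj_extend h p 0).symm
  · obtain ⟨m, rfl⟩ : ∃ m, n = m + 1 := ⟨n - 1, by omega⟩
    have hs := contDiffOn_partialY hf.isOpen hf.smooth (Fin.last (m + 1))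
    have key : ∀ t, totalDerivIter (m + 1) (partialY f (Fin.last (m + 1)))
        (Jet.proj (by omega) (Jet.extend p t)) =
        fderiv ℝ (totalDerivIter m (partialY f (Fin.last (m + 1)))) (Jet.proj (by omega) p)
          (Jet.projL (by omega) (solField (fun _ => t) p)) := fun t =>
      totalDeriv_extend _ (by omega : m + 1 + 1 + m ≤ 2 * (m + 1)) p t
    have e : ∀ t, Jet.projL (by omega : m + 1 + 1 + m ≤ 2 * (m + 1)) (solField (fun _ => t) p) =
        Jet.projL (by omega) (solField (fun _ => 0) p) + t • Jet.back (m + 1 + 1 + m) 0 := by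
      intro t
      have h0 : solField (fun _ => t) p = solField (fun _ => 0) p + t • Jet.back (2 * (m + 1)) 0 := by
        rw [solField_eq, solField_eq]
        simp
      rw [h0, map_add, map_smul, Jet.projL_back _ (by omega)]
    have h2 := fderiv_totalDerivIter_back hf.isOpen hs m
      (j := Jet.proj (by omega : m + 1 + 1 + m ≤ 2 * (m + 1)) p) hp
    simp only [Fin.val_last]
    rw [key, key, e t, map_add, map_smul, h2, partialY, Jet.single_last]
    simp only [smul_eq_mul]
    have e3 : Jet.proj (Nat.le_add_right (m + 1 + 1) m)
      (Jet.proj (by omega : m + 1 + 1 + m ≤ 2 * (m + 1)) p) = Jet.proj (by omega) p := rfl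
    rw [e3]
    ring

variable {F : Jet (2 * n) → ℝ}

theorem eulerLagrange_solution (hF : IsEulerLagrangeEquation f U F) (hn : 0 < n) {p : Jet (2 * n)}
    (hp : Jet.proj (by omega : n + 1 ≤ 2 * n) p ∈ U) :
    eulerLagrange f (Jet.extend p (F p)) = 0 := by
  refine (hF (Jet.extend p (F p)) ?_).2 ?_
  · rw [Jet.proj_extend (by omega : n + 1 ≤ 2 * n)]
    exact hp
  · have h : Jet.proj (Nat.le_succ (2 * n)) (Jet.extend p (F p)) = p :=
      Jet.proj_extend le_rfl p (F p)
    rw [h]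
    simp [Jet.extend]

/-- The solved form of the Euler–Lagrange equation of a nondegenerate Lagrangian is smooth. -/
theorem contDiffOn_solvedForm (hf : IsNondegenerateLagrangian f U)
    (hF : IsEulerLagrangeEquation f U F) (hn : 0 < n) :
    ContDiffOn ℝ ∞ F (Jet.proj (by omega : n + 1 ≤ 2 * n) ⁻¹' U) := by
  have hc : ContDiffOn ℝ ∞ (fun p : Jet (2 * n) => (-1) ^ n *
      partialY (partialY f (Fin.last n)) (Fin.last n) (Jet.proj (by omega) p))
      (Jet.proj (by omega : n + 1 ≤ 2 * n) ⁻¹' U) :=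
    contDiffOn_const.mul ((contDiffOn_partialY hf.isOpen
      (contDiffOn_partialY hf.isOpen hf.smooth _) _).comp
      (Jet.projL (by omega)).contDiff.contDiffOn fun _ h => h)
  have hE : ContDiffOn ℝ ∞ (fun p : Jet (2 * n) => eulerLagrange f (Jet.extend p 0))
      (Jet.proj (by omega : n + 1 ≤ 2 * n) ⁻¹' U) := by
    refine (contDiffOn_eulerLagrange hf).comp (Jet.contDiff_extend 0).contDiffOn fun p hp => ?_
    rw [Set.mem_preimage, Jet.proj_extend (by omega : n + 1 ≤ 2 * n)]
    exact hp
  have hne : ∀ p ∈ Jet.proj (by omega : n + 1 ≤ 2 * n) ⁻¹' U, (-1 : ℝ) ^ n *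
      partialY (partialY f (Fin.last n)) (Fin.last n) (Jet.proj (by omega) p) ≠ 0 := fun p hp =>
    mul_ne_zero (pow_ne_zero _ (by norm_num)) (hf.nondegenerate _ hp)
  -- F is the root of the affine function of y_{2n} given by `eulerLagrange_extend`, a quotient of
  -- smooth functions.
  refine (hE.neg.mul (hc.inv hne)).congr fun p hp => ?_
  have h1 := eulerLagrange_solution hF hn hp
  rw [eulerLagrange_extend hf hn hp] at h1
  change F p = -eulerLagrange f (Jet.extend p 0) * (_ * _)⁻¹
  rw [← div_eq_mul_inv, eq_div_iff (hne p hp)]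
  linarith

end EulerLagrange

/-! ### Generalized momenta on the equation -/

section PoincareCartan

/-- The derivative of a function along the solution field. -/
def fieldDeriv {N : ℕ} (F g : Jet N → ℝ) (p : Jet N) : ℝ := fderiv ℝ g p (solField F p)

section FieldDeriv

variable {N : ℕ} {F g : Jet N → ℝ} {s : Set (Jet N)}

theorem contDiffOn_fieldDeriv (hs : IsOpen s) (hF : ContDiffOn ℝ ∞ F s)
    (hg : ContDiffOn ℝ ∞ g s) : ContDiffOn ℝ ∞ (fieldDeriv F g) s :=
  (hg.fderiv_of_isOpen hs (by simp)).clm_apply (contDiffOn_solField hF)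

theorem contDiffOn_fieldDeriv_iterate (hs : IsOpen s) (hF : ContDiffOn ℝ ∞ F s)
    (hg : ContDiffOn ℝ ∞ g s) (r : ℕ) : ContDiffOn ℝ ∞ ((fieldDeriv F)^[r] g) s := by
  induction r with
  | zero => exact hg
  | succ r ih =>
    rw [Function.iterate_succ_apply']
    exact contDiffOn_fieldDeriv hs hF ih

/-- Symmetry of the second derivative interchanges v with X; the extra term is dg applied to the
derivative of X in the direction v. -/
theorem fderiv_fieldDeriv (hs : IsOpen s) (hF : ContDiffOn ℝ ∞ F s) (hg : ContDiffOn ℝ ∞ g s)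
    {p : Jet N} (hp : p ∈ s) (v : Jet N) : fderiv ℝ (fieldDeriv F g) p v =
      fderiv ℝ (fun q => fderiv ℝ g q v) p (solField F p) +
        fderiv ℝ g p (Jet.shift N v + fderiv ℝ F p v • Jet.back N 0) := by
  have hFd : DifferentiableAt ℝ F p :=
    (hF.contDiffAt (hs.mem_nhds hp)).differentiableAt (by simp)
  have hg' : DifferentiableAt ℝ (fderiv ℝ g) p :=
    ((hg.fderiv_of_isOpen hs (m := ∞) (by simp)).contDiffAt (hs.mem_nhds hp)).differentiableAt
      (by simp)
  have hsymm : IsSymmSndFDerivAt ℝ g p :=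
    (hg.contDiffAt (hs.mem_nhds hp)).isSymmSndFDerivAt
      minSmoothness_two_le_infty
  have h1 := hg'.hasFDerivAt.clm_apply (hasFDerivAt_solField hFd)
  have h2 := hg'.hasFDerivAt.clm_apply (hasFDerivAt_const v p)
  unfold fieldDeriv
  rw [h1.fderiv, h2.fderiv]
  simp only [add_apply, ContinuousLinearMap.comp_apply, ContinuousLinearMap.flip_apply,
    ContinuousLinearMap.smulRight_apply, hsymm.eq v (solField F p)]
  simp
  ring

/-- The derivative of `g` vanishes on `∂/∂y_{N-1-k}` for `k < K`, and is `c` for `k = K`. -/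
def HasTopDeriv (g : Jet N → ℝ) (s : Set (Jet N)) (K : ℕ) (c : Jet N → ℝ) : Prop :=
  ∀ p ∈ s, (∀ k < K, fderiv ℝ g p (Jet.back N k) = 0) ∧ fderiv ℝ g p (Jet.back N K) = c p

/-- Commuting `back N k` past X produces `back N (k + 1)` and a multiple of `back N 0`, and the
latter kills g. So differentiation along X raises the order by one and keeps the top coefficient. -/
theorem HasTopDeriv.fieldDeriv (hs : IsOpen s) (hF : ContDiffOn ℝ ∞ F s)
    (hg : ContDiffOn ℝ ∞ g s) {K : ℕ} {c : Jet N → ℝ} (h : HasTopDeriv g s (K + 1) c) :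
    HasTopDeriv (fieldDeriv F g) s K c := by
  intro p hp
  have key : ∀ k ≤ K, fderiv ℝ (_root_.fieldDeriv F g) p (Jet.back N k) =
      fderiv ℝ g p (Jet.back N (k + 1)) := by
    intro k hk
    rw [fderiv_fieldDeriv hs hF hg hp]
    have hz : fderiv ℝ (fun q => fderiv ℝ g q (Jet.back N k)) p = 0 := by
      rw [Filter.EventuallyEq.fderiv_eq (f := fun _ => (0 : ℝ))]
      · simp
      · filter_upwards [hs.mem_nhds hp] with q hq
        exact (h q hq).1 k (by omega)
    rw [hz, Jet.shift_back, map_add, map_smul, (h p hp).1 0 (by omega)]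
    simp
  refine ⟨fun k hk => ?_, ?_⟩
  · rw [key k hk.le, (h p hp).1 _ (by omega)]
  · rw [key K le_rfl, (h p hp).2]

theorem HasTopDeriv.of_sub {g₁ g₂ : Jet N → ℝ} (hs : IsOpen s) (h₁ : DifferentiableOn ℝ g₁ s)
    (h₂ : DifferentiableOn ℝ g₂ s) {K : ℕ} {c₁ c₂ : Jet N → ℝ} (H₁ : HasTopDeriv g₁ s K c₁)
    (H₂ : HasTopDeriv g₂ s K c₂) (h : ∀ p ∈ s, g p = g₁ p - g₂ p) :
    HasTopDeriv g s K fun p => c₁ p - c₂ p := by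
  intro p hp
  have e : ∀ v, fderiv ℝ g p v = fderiv ℝ g₁ p v - fderiv ℝ g₂ p v := by
    intro v
    rw [Filter.EventuallyEq.fderiv_eq (f := fun q => g₁ q - g₂ q)
      (by filter_upwards [hs.mem_nhds hp] with q hq using h q hq),
      fderiv_fun_sub (h₁.differentiableAt (hs.mem_nhds hp)) (h₂.differentiableAt (hs.mem_nhds hp))]
    rfl
  refine ⟨fun k hk => ?_, ?_⟩
  · rw [e, (H₁ p hp).1 k hk, (H₂ p hp).1 k hk, sub_zero]
  · rw [e, (H₁ p hp).2, (H₂ p hp).2]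

theorem fieldDeriv_comp_proj {m : ℕ} {h : Jet m → ℝ} (hm : m ≤ N) {p : Jet N}
    (hh : DifferentiableAt ℝ h (Jet.proj hm p)) :
    fieldDeriv F (fun q => h (Jet.proj hm q)) p =
      totalDeriv h (Jet.proj (Nat.succ_le_succ hm) (Jet.extend p (F p))) := by
  rw [totalDeriv_extend, fieldDeriv]
  have h1 : HasFDerivAt (fun q => h (Jet.projL hm q)) _ p :=
    HasFDerivAt.comp p (f := Jet.projL hm) hh.hasFDerivAt (Jet.projL hm).hasFDerivAt
  exact congrArg (fun l : Jet N →L[ℝ] ℝ => l (solField F p)) h1.fderiv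

/-- On the equation d/dx becomes differentiation along X. The bound m + r ≤ N + 1 allows the last
total derivative to involve y_N, which `extend p (F p)` replaces by F. -/
theorem fieldDeriv_iterate_comp_proj {m : ℕ} {h : Jet m → ℝ} {V : Set (Jet m)} (hV : IsOpen V)
    (hh : ContDiffOn ℝ ∞ h V) (hm : m ≤ N) (r : ℕ) (hr : m + r ≤ N + 1) {p : Jet N}
    (hp : Jet.proj hm p ∈ V) :
    (fieldDeriv F)^[r] (fun q => h (Jet.proj hm q)) p =
      totalDerivIter r h (Jet.proj hr (Jet.extend p (F p))) := by
  induction r generalizing p with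
  | zero =>
    exact congrArg h (Jet.proj_extend hm p (F p)).symm
  | succ r ih =>
    have hr' : m + r ≤ N := by omega
    rw [Function.iterate_succ_apply']
    have e : (fieldDeriv F)^[r] (fun q => h (Jet.proj hm q)) =ᶠ[𝓝 p]
        fun q => totalDerivIter r h (Jet.proj hr' q) := by
      have : Jet.projL hm ⁻¹' V ∈ 𝓝 p := (hV.preimage (Jet.projL hm).continuous).mem_nhds hp
      filter_upwards [this] with q hq
      rw [ih (by omega) hq]
      exact congrArg _ (Jet.proj_extend hr' q (F q))
    rw [fieldDeriv, e.fderiv_eq]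
    refine fieldDeriv_comp_proj hr' ?_
    exact ((contDiffOn_totalDerivIter hV hh r).contDiffAt
      ((hV.preimage (Jet.projL _).continuous).mem_nhds hp)).differentiableAt (by simp)

end FieldDeriv

section Momenta

variable {n : ℕ}

/-- The partial derivative `∂f/∂y_j` of a Lagrangian as a function on its Euler–Lagrange
equation. -/
def lagrangianPartial (h : n + 1 ≤ 2 * n) (f : Jet (n + 1) → ℝ) (j : ℕ) (p : Jet (2 * n)) : ℝ :=
  partialY f (Fin.ofNat (n + 1) j) (Jet.proj h p)

/-- The generalized momentum `∑ (-1)^k d^k/dx^k (∂f/∂y_{j+k})` restricted to the equation. -/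
def momentum (h : n + 1 ≤ 2 * n) (F : Jet (2 * n) → ℝ) (f : Jet (n + 1) → ℝ) (j : ℕ)
    (p : Jet (2 * n)) : ℝ :=
  ∑ k ∈ Finset.range (n + 1 - j),
    (-1) ^ k * (fieldDeriv F)^[k] (lagrangianPartial h f (j + k)) p

variable {h : n + 1 ≤ 2 * n} {F : Jet (2 * n) → ℝ} {f : Jet (n + 1) → ℝ} {U : Set (Jet (n + 1))}

theorem isOpen_preimage_proj {k m : ℕ} (h : k ≤ m) {U : Set (Jet k)} (hU : IsOpen U) :
    IsOpen (Jet.proj h ⁻¹' U) := hU.preimage (Jet.projL h).continuous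

theorem contDiffOn_lagrangianPartial (hf : IsNondegenerateLagrangian f U) (j : ℕ) :
    ContDiffOn ℝ ∞ (lagrangianPartial h f j) (Jet.proj h ⁻¹' U) :=
  (contDiffOn_partialY hf.isOpen hf.smooth _).comp (Jet.projL h).contDiff.contDiffOn fun _ h => h

theorem contDiffOn_momentum (hf : IsNondegenerateLagrangian f U)
    (hF : ContDiffOn ℝ ∞ F (Jet.proj h ⁻¹' U)) (j : ℕ) :
    ContDiffOn ℝ ∞ (momentum h F f j) (Jet.proj h ⁻¹' U) := by
  unfold momentum
  exact ContDiffOn.sum fun k _ => contDiffOn_const.mul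
    (contDiffOn_fieldDeriv_iterate (isOpen_preimage_proj h hf.isOpen) hF
      (contDiffOn_lagrangianPartial hf _) k)

/-- The term k = 0 splits off, and the others form -X of the next momentum, which is an empty sum
when j = n. -/
theorem momentum_eq (hf : IsNondegenerateLagrangian f U)
    (hF : ContDiffOn ℝ ∞ F (Jet.proj h ⁻¹' U)) {j : ℕ} (hj : j ≤ n) {p : Jet (2 * n)}
    (hp : Jet.proj h p ∈ U) : momentum h F f j p =
      lagrangianPartial h f j p - fieldDeriv F (momentum h F f (j + 1)) p := by
  have e1 : n + 1 - j = (n + 1 - (j + 1)) + 1 := by omega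
  have hd : ∀ k ∈ Finset.range (n + 1 - (j + 1)), DifferentiableAt ℝ
      (fun q => (-1) ^ k * (fieldDeriv F)^[k] (lagrangianPartial h f (j + 1 + k)) q) p := by
    intro k _
    have := (contDiffOn_fieldDeriv_iterate (isOpen_preimage_proj h hf.isOpen) hF
      (contDiffOn_lagrangianPartial (h := h) hf (j + 1 + k)) k).contDiffAt
      ((isOpen_preimage_proj h hf.isOpen).mem_nhds hp)
    exact (this.differentiableAt (by simp)).const_mul _
  have e2 : fieldDeriv F (momentum h F f (j + 1)) p =
      ∑ k ∈ Finset.range (n + 1 - (j + 1)),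
        (-1) ^ k * (fieldDeriv F)^[k + 1] (lagrangianPartial h f (j + 1 + k)) p := by
    unfold momentum
    rw [fieldDeriv, fderiv_fun_sum hd, sum_apply]
    refine Finset.sum_congr rfl fun k hk => ?_
    have := (contDiffOn_fieldDeriv_iterate (isOpen_preimage_proj h hf.isOpen) hF
      (contDiffOn_lagrangianPartial (h := h) hf (j + 1 + k)) k).contDiffAt
      ((isOpen_preimage_proj h hf.isOpen).mem_nhds hp)
    rw [fderiv_const_mul (this.differentiableAt (by simp)), Function.iterate_succ_apply']
    rfl
  rw [e2, momentum, e1, Finset.sum_range_succ', add_comm, sub_eq_add_neg, ← Finset.sum_neg_distrib]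
  congr 1
  · simp
  · refine Finset.sum_congr rfl fun k _ => ?_
    rw [pow_succ, show j + (k + 1) = j + 1 + k by omega]
    ring

theorem momentum_last (p : Jet (2 * n)) : momentum h F f n p = lagrangianPartial h f n p := by
  simp [momentum]

/-- For index 0 the sum is the Euler–Lagrange expression with its total derivatives taken along X.
-/
theorem momentum_zero (hf : IsNondegenerateLagrangian f U) (hF : IsEulerLagrangeEquation f U F)
    (hn : 0 < n) {p : Jet (2 * n)} (hp : Jet.proj h p ∈ U) : momentum h F f 0 p = 0 := by
  rw [← eulerLagrange_solution hF hn hp, momentum, eulerLagrange, Nat.sub_zero, Finset.sum_range]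
  refine Finset.sum_congr rfl fun k _ => ?_
  congr 1
  have := fieldDeriv_iterate_comp_proj (F := F) hf.isOpen
    (contDiffOn_partialY hf.isOpen hf.smooth k) h (k : ℕ) (by omega) hp
  rw [← this]
  -- `Fin.ofNat (n + 1)` reduces modulo n + 1, harmlessly because k ≤ n.
  have e : lagrangianPartial h f (0 + (k : ℕ)) = fun q => partialY f k (Jet.proj h q) := by
    funext q
    rw [lagrangianPartial, Nat.zero_add]
    congr 1
    ext
    simp
  rw [e]

theorem fderiv_comp_proj {k m : ℕ} (h : k ≤ m) {g : Jet k → ℝ} {p : Jet m}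
    (hg : DifferentiableAt ℝ g (Jet.proj h p)) (v : Jet m) :
    fderiv ℝ (fun q => g (Jet.proj h q)) p v = fderiv ℝ g (Jet.proj h p) (Jet.projL h v) := by
  have h1 : HasFDerivAt (fun q => g (Jet.projL h q)) _ p :=
    HasFDerivAt.comp p (f := Jet.projL h) hg.hasFDerivAt (Jet.projL h).hasFDerivAt
  exact congrArg (fun l : Jet m →L[ℝ] ℝ => l v) h1.fderiv

theorem hasTopDeriv_lagrangianPartial (hf : IsNondegenerateLagrangian f U) (j : ℕ) {K : ℕ}
    (hK : K + 1 < n) : HasTopDeriv (lagrangianPartial h f j) (Jet.proj h ⁻¹' U) K fun _ => 0 := by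
  intro p hp
  have key : ∀ k ≤ K, fderiv ℝ (lagrangianPartial h f j) p (Jet.back (2 * n) k) = 0 := by
    intro k hk
    unfold lagrangianPartial
    rw [fderiv_comp_proj h, Jet.projL_back_of_lt h (by omega), map_zero]
    exact ((contDiffOn_partialY hf.isOpen hf.smooth _).contDiffAt
      (hf.isOpen.mem_nhds hp)).differentiableAt (by simp)
  exact ⟨fun k hk => key k hk.le, key K le_rfl⟩

theorem Jet.projL_back_top (h : n + 1 ≤ 2 * n) :
    Jet.projL h (Jet.back (2 * n) (n - 1)) = Jet.back (n + 1) 0 := by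
  ext i
  · rfl
  · change (Jet.back (2 * n) (n - 1)).2 (Fin.castLE h i) = _
    rw [Jet.back_snd, Jet.back_snd]
    congr 1
    simp
    omega

/-- Here `back (2 * n) (n - 1 - r)` is ∂/∂y_{n+r}. Starting from ∂f/∂y_n of order n, each use of
`momentum_eq` raises the order by one and flips the sign; the partial derivatives of f, of order at
most n, do not interfere. -/
theorem hasTopDeriv_momentum (hf : IsNondegenerateLagrangian f U)
    (hF : ContDiffOn ℝ ∞ F (Jet.proj h ⁻¹' U)) (r : ℕ) (hr : r < n) :
    HasTopDeriv (momentum h F f (n - r)) (Jet.proj h ⁻¹' U) (n - 1 - r)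
      fun p => (-1) ^ r * partialY (partialY f (Fin.last n)) (Fin.last n) (Jet.proj h p) := by
  have hs := isOpen_preimage_proj h hf.isOpen
  induction r with
  | zero =>
    intro p hp
    have hd : DifferentiableAt ℝ (partialY f (Fin.last n)) (Jet.proj h p) :=
      ((contDiffOn_partialY hf.isOpen hf.smooth _).contDiffAt
        (hf.isOpen.mem_nhds hp)).differentiableAt (by simp)
    have e : momentum h F f (n - 0) = fun q => partialY f (Fin.last n) (Jet.proj h q) := by
      funext q
      rw [Nat.sub_zero, momentum_last, lagrangianPartial]
      congr 1
      ext
      simp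
    rw [e]
    refine ⟨fun k hk => ?_, ?_⟩
    · rw [fderiv_comp_proj h hd, Jet.projL_back_of_lt h (by omega), map_zero]
    · rw [fderiv_comp_proj h hd, Nat.sub_zero, Jet.projL_back_top, ← Jet.single_last]
      simp [partialY]
  | succ r ih =>
    have h1 := ih (by omega)
    rw [show n - 1 - r = n - 1 - (r + 1) + 1 by omega] at h1
    have h2 := HasTopDeriv.fieldDeriv hs hF (contDiffOn_momentum hf hF _) h1
    have h3 := HasTopDeriv.of_sub hs
      ((contDiffOn_lagrangianPartial (h := h) hf (n - (r + 1))).differentiableOn (by simp))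
      ((contDiffOn_fieldDeriv hs hF (contDiffOn_momentum hf hF (n - r))).differentiableOn (by simp))
      (hasTopDeriv_lagrangianPartial hf (n - (r + 1)) (by omega)) h2
      (g := momentum h F f (n - (r + 1))) (fun p hp => by
        rw [momentum_eq hf hF (by omega) hp, show n - (r + 1) + 1 = n - r by omega])
    convert h3 using 2
    rw [pow_succ]
    ring

end Momenta

end PoincareCartan

/-! ### The Poincaré–Cartan form: existence of an adapted form -/

section PoincareCartanForm

/-- The coordinate `y_i` as a continuous linear functional (zero for `i ≥ N`). -/
def Jet.coord (N i : ℕ) : Jet N →L[ℝ] ℝ :=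
  if h : i < N then (ContinuousLinearMap.proj (⟨i, h⟩ : Fin N)).comp
    (ContinuousLinearMap.snd ℝ ℝ (Fin N → ℝ)) else 0

theorem Jet.coord_apply {N i : ℕ} (h : i < N) (v : Jet N) : Jet.coord N i v = v.2 ⟨i, h⟩ := by
  rw [Jet.coord, dif_pos h]; rfl

theorem Jet.coord_back {N i : ℕ} (h : i < N) (k : ℕ) :
    Jet.coord N i (Jet.back N k) = if i + k + 1 = N then 1 else 0 := by
  rw [Jet.coord_apply h, Jet.back_snd]

theorem Jet.coord_solField {N i : ℕ} (h : i + 1 < N) (F : Jet N → ℝ) (p : Jet N) :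
    Jet.coord N i (solField F p) = Jet.coord N (i + 1) p := by
  rw [Jet.coord_apply (by omega), Jet.coord_apply h]
  change (Jet.extend p (F p)).2 (Fin.succ _) = _
  rw [extend_snd_succ, Jet.shift_snd, Jet.back_snd, dif_pos h, if_neg (by simp; omega)]
  simp

theorem fderiv_eq_sum_partialY {k : ℕ} (g : Jet k → ℝ) (q u : Jet k) :
    fderiv ℝ g q u = u.1 * fderiv ℝ g q (1, 0) + ∑ i, u.2 i * partialY g i q := by
  have e : u = u.1 • ((1, 0) : Jet k) + ∑ i, u.2 i • ((0, Pi.single i 1) : Jet k) := by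
    ext j
    · simp [Prod.fst_sum]
    · simp [Prod.snd_sum, Pi.single_apply]
  conv_lhs => rw [e]
  rw [map_add, map_smul, map_sum]
  simp only [map_smul, smul_eq_mul, partialY]

variable {n : ℕ} {h : n + 1 ≤ 2 * n} {F : Jet (2 * n) → ℝ} {f : Jet (n + 1) → ℝ}
  {U : Set (Jet (n + 1))}

/-- The Poincaré–Cartan 1-form `f dx + ∑ E_{i+1} (dy_i - y_{i+1} dx)`. -/
def cartanForm (h : n + 1 ≤ 2 * n) (F : Jet (2 * n) → ℝ) (f : Jet (n + 1) → ℝ) (p : Jet (2 * n)) :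
    Jet (2 * n) →L[ℝ] ℝ :=
  f (Jet.proj h p) • ContinuousLinearMap.fst ℝ ℝ _ + ∑ i ∈ Finset.range n,
    momentum h F f (i + 1) p • (Jet.coord _ i - Jet.coord _ (i + 1) p •
      ContinuousLinearMap.fst ℝ ℝ _)

/-- The exterior derivative of the Poincaré–Cartan form. -/
def cartanTwoForm (h : n + 1 ≤ 2 * n) (F : Jet (2 * n) → ℝ) (f : Jet (n + 1) → ℝ) :
    EqForm (2 * n) :=
  extDeriv fun p => ContinuousAlternatingMap.ofSubsingleton ℝ (Jet (2 * n)) ℝ (0 : Fin 1)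
    (cartanForm h F f p)

theorem contDiffOn_cartanForm (hf : IsNondegenerateLagrangian f U)
    (hF : ContDiffOn ℝ ∞ F (Jet.proj h ⁻¹' U)) :
    ContDiffOn ℝ ∞ (cartanForm h F f) (Jet.proj h ⁻¹' U) := by
  unfold cartanForm
  refine ((hf.smooth.comp (Jet.projL h).contDiff.contDiffOn fun _ h => h).smul
    contDiffOn_const).add (ContDiffOn.sum fun i _ => (contDiffOn_momentum hf hF _).smul ?_)
  exact contDiffOn_const.sub ((Jet.coord _ (i + 1)).contDiff.contDiffOn.smul contDiffOn_const)

theorem contDiffOn_cartanForm_ofSubsingleton (hf : IsNondegenerateLagrangian f U)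
    (hF : ContDiffOn ℝ ∞ F (Jet.proj h ⁻¹' U)) :
    ContDiffOn ℝ ∞ (fun p => ContinuousAlternatingMap.ofSubsingleton ℝ (Jet (2 * n)) ℝ (0 : Fin 1)
      (cartanForm h F f p)) (Jet.proj h ⁻¹' U) :=
  (ContinuousAlternatingMap.ofSubsingletonLIE (𝕜 := ℝ) (E := Jet (2 * n)) (F := ℝ) (0 : Fin 1)).toContinuousLinearEquiv.contDiff.comp_contDiffOn
    (contDiffOn_cartanForm hf hF)

theorem contDiffOn_cartanTwoForm (hf : IsNondegenerateLagrangian f U)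
    (hF : ContDiffOn ℝ ∞ F (Jet.proj h ⁻¹' U)) :
    ContDiffOn ℝ ∞ (cartanTwoForm h F f) (Jet.proj h ⁻¹' U) := by
  have h1 := (contDiffOn_cartanForm_ofSubsingleton hf hF).fderiv_of_isOpen
    (isOpen_preimage_proj h hf.isOpen) (m := ∞) (by simp)
  exact (ContinuousAlternatingMap.alternatizeUncurryFinCLM ℝ (Jet (2 * n)) ℝ).contDiff.comp_contDiffOn h1

theorem extDeriv_cartanTwoForm (hf : IsNondegenerateLagrangian f U)
    (hF : ContDiffOn ℝ ∞ F (Jet.proj h ⁻¹' U)) {p : Jet (2 * n)} (hp : Jet.proj h p ∈ U) :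
    extDeriv (cartanTwoForm h F f) p = 0 :=
  extDeriv_extDeriv_apply ((contDiffOn_cartanForm_ofSubsingleton hf hF).contDiffAt
    ((isOpen_preimage_proj h hf.isOpen).mem_nhds hp))
    minSmoothness_two_le_infty

theorem fderiv_cartanForm (hf : IsNondegenerateLagrangian f U)
    (hF : ContDiffOn ℝ ∞ F (Jet.proj h ⁻¹' U)) {p : Jet (2 * n)} (hp : Jet.proj h p ∈ U)
    (v w : Jet (2 * n)) : fderiv ℝ (fun q => cartanForm h F f q w) p v =
      (v.1 * fderiv ℝ f (Jet.proj h p) (1, 0) +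
        ∑ j ∈ Finset.range (n + 1), lagrangianPartial h f j p * Jet.coord _ j v) * w.1 +
      ∑ i ∈ Finset.range n, (fderiv ℝ (momentum h F f (i + 1)) p v *
        (Jet.coord _ i w - Jet.coord _ (i + 1) p * w.1) -
          momentum h F f (i + 1) p * Jet.coord _ (i + 1) v * w.1) := by
  have hnhds := (isOpen_preimage_proj h hf.isOpen).mem_nhds hp
  have hfd : DifferentiableAt ℝ f (Jet.proj h p) :=
    (hf.smooth.contDiffAt (hf.isOpen.mem_nhds hp)).differentiableAt (by simp)
  have hfp : DifferentiableAt ℝ (fun q : Jet (2 * n) => f (Jet.proj h q)) p :=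
    DifferentiableAt.comp p (f := Jet.projL h) hfd (Jet.projL h).differentiableAt
  have hm : ∀ j, DifferentiableAt ℝ (momentum h F f j) p := fun j =>
    ((contDiffOn_momentum hf hF j).contDiffAt hnhds).differentiableAt (by simp)
  have e : (fun q => cartanForm h F f q w) = fun q => f (Jet.proj h q) * w.1 +
      ∑ i ∈ Finset.range n, momentum h F f (i + 1) q *
        (Jet.coord _ i w - Jet.coord _ (i + 1) q * w.1) := by
    funext q
    simp [cartanForm]
  have hd := (hfp.hasFDerivAt.mul_const w.1).fun_add
    (HasFDerivAt.fun_sum (u := Finset.range n) fun i _ => (hm (i + 1)).hasFDerivAt.fun_mul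
      (((Jet.coord (2 * n) (i + 1)).hasFDerivAt.mul_const w.1).const_sub (Jet.coord _ i w)))
  rw [e, hd.fderiv]
  have hsum : fderiv ℝ (fun q => f (Jet.proj h q)) p v =
      v.1 * fderiv ℝ f (Jet.proj h p) (1, 0) +
        ∑ j ∈ Finset.range (n + 1), lagrangianPartial h f j p * Jet.coord _ j v := by
    rw [fderiv_comp_proj h hfd, fderiv_eq_sum_partialY, Finset.sum_range]
    congr 1
    refine Finset.sum_congr rfl fun i _ => ?_
    rw [Jet.coord_apply (by omega), mul_comm, lagrangianPartial]
    congr 2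
    ext
    simp
  simp only [add_apply, smul_apply, sum_apply, smul_eq_mul, hsum, neg_apply]
  congr 1
  · ring
  · refine Finset.sum_congr rfl fun i _ => ?_
    ring

/-- The sum is ∑ (dE_{i+1} - X(E_{i+1}) dx) ∧ θ_i. Replacing X(E_{i+1}) by ∂f/∂y_i - E_i matches the
df ∧ dx part, and the remaining momentum terms telescope. -/
theorem cartanTwoForm_apply (hf : IsNondegenerateLagrangian f U)
    (hF : ContDiffOn ℝ ∞ F (Jet.proj h ⁻¹' U)) (hEL : IsEulerLagrangeEquation f U F)
    (hn : 0 < n) {p : Jet (2 * n)} (hp : Jet.proj h p ∈ U) (v w : Jet (2 * n)) :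
    cartanTwoForm h F f p ![v, w] = ∑ i ∈ Finset.range n,
      (fderiv ℝ (momentum h F f (i + 1)) p (v - v.1 • solField F p) *
          (Jet.coord _ i w - Jet.coord _ (i + 1) p * w.1) -
        fderiv ℝ (momentum h F f (i + 1)) p (w - w.1 • solField F p) *
          (Jet.coord _ i v - Jet.coord _ (i + 1) p * v.1)) := by
  have hd := ((contDiffOn_cartanForm_ofSubsingleton hf hF).contDiffAt
    ((isOpen_preimage_proj h hf.isOpen).mem_nhds hp)).differentiableAt (by simp)
  have e : cartanTwoForm h F f p ![v, w] = fderiv ℝ (fun q => cartanForm h F f q w) p v -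
      fderiv ℝ (fun q => cartanForm h F f q v) p w := by
    rw [cartanTwoForm, extDeriv_apply hd, Fin.sum_univ_two]
    simp [Fin.removeNth, sub_eq_add_neg]
  have hX : ∀ i ∈ Finset.range n, fderiv ℝ (momentum h F f (i + 1)) p (solField F p) =
      lagrangianPartial h f i p - momentum h F f i p := by
    intro i hi
    have := momentum_eq (h := h) hf hF (Finset.mem_range.1 hi).le hp
    rw [fieldDeriv] at this
    linarith
  have e0 := momentum_zero (h := h) hf hEL hn hp
  have en := momentum_last (h := h) (F := F) (f := f) p
  -- An index shift; its boundary terms are E_0 = 0 and E_n = ∂f/∂y_n.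
  have tel : ∑ i ∈ Finset.range n, momentum h F f (i + 1) p *
      (Jet.coord _ (i + 1) v * w.1 - Jet.coord _ (i + 1) w * v.1) =
      ∑ i ∈ Finset.range n, momentum h F f i p * (Jet.coord _ i v * w.1 - Jet.coord _ i w * v.1) +
        lagrangianPartial h f n p * (Jet.coord _ n v * w.1 - Jet.coord _ n w * v.1) := by
    have := Finset.sum_range_succ' (fun i => momentum h F f i p *
      (Jet.coord _ i v * w.1 - Jet.coord _ i w * v.1)) n
    rw [Finset.sum_range_succ, e0, en] at this
    linarith
  have split : ∑ i ∈ Finset.range n,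
      (fderiv ℝ (momentum h F f (i + 1)) p (v - v.1 • solField F p) *
          (Jet.coord _ i w - Jet.coord _ (i + 1) p * w.1) -
        fderiv ℝ (momentum h F f (i + 1)) p (w - w.1 • solField F p) *
          (Jet.coord _ i v - Jet.coord _ (i + 1) p * v.1)) =
      ∑ i ∈ Finset.range n, (fderiv ℝ (momentum h F f (i + 1)) p v *
          (Jet.coord _ i w - Jet.coord _ (i + 1) p * w.1) -
        fderiv ℝ (momentum h F f (i + 1)) p w *
          (Jet.coord _ i v - Jet.coord _ (i + 1) p * v.1) +
        lagrangianPartial h f i p * (Jet.coord _ i v * w.1) -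
        lagrangianPartial h f i p * (Jet.coord _ i w * v.1) -
        momentum h F f i p * (Jet.coord _ i v * w.1 - Jet.coord _ i w * v.1)) := by
    refine Finset.sum_congr rfl fun i hi => ?_
    rw [map_sub, map_sub, map_smul, map_smul, hX i hi, smul_eq_mul, smul_eq_mul]
    ring
  rw [e, fderiv_cartanForm hf hF hp, fderiv_cartanForm hf hF hp, split]
  simp only [Finset.sum_add_distrib, Finset.sum_sub_distrib, Finset.sum_range_succ, add_mul,
    Finset.sum_mul, mul_sub] at tel ⊢
  simp only [← mul_assoc] at tel ⊢
  linear_combination -tel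

/-- X is killed by every factor in `cartanTwoForm_apply`, and V^n by each θ_i with i < n. That the
kernel is no larger follows from the triangular shape of the dE_{j+1}. -/
theorem isAdaptedForm_cartanTwoForm (hf : IsNondegenerateLagrangian f U)
    (hEL : IsEulerLagrangeEquation f U F) (hn : 2 ≤ n) {W : TopologicalSpace.Opens (Jet (2 * n))}
    (hW : ∀ p ∈ W, Jet.proj h p ∈ U) : IsAdaptedForm F W n (cartanTwoForm h F f) := by
  have hn0 : 0 < n := by omega
  have hF : ContDiffOn ℝ ∞ F (Jet.proj h ⁻¹' U) := contDiffOn_solvedForm hf hEL hn0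
  have hX : ∀ p ∈ W, ∀ w, cartanTwoForm h F f p ![solField F p, w] = 0 := by
    intro p hp w
    rw [cartanTwoForm_apply hf hF hEL hn0 (hW p hp)]
    refine Finset.sum_eq_zero fun i hi => ?_
    have := Finset.mem_range.1 hi
    rw [solField_fst, one_smul, sub_self, map_zero, Jet.coord_solField (by omega)]
    ring
  refine ⟨(contDiffOn_cartanTwoForm hf hF).mono hW,
    fun p hp => extDeriv_cartanTwoForm hf hF (hW p hp), fun p hp v => ⟨fun hv => ?_, fun hv w => ?_⟩,
    fun p hp v hv w hw => ?_⟩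
  · have apply := cartanTwoForm_apply hf hF hEL hn0 (hW p hp)
    have top : ∀ j < n, (∀ k < j, fderiv ℝ (momentum h F f (j + 1)) p (Jet.back _ k) = 0) ∧
        fderiv ℝ (momentum h F f (j + 1)) p (Jet.back _ j) ≠ 0 := by
      intro j hj
      have := hasTopDeriv_momentum (h := h) hf hF (n - 1 - j) (by omega) p (hW p hp)
      rw [show n - (n - 1 - j) = j + 1 by omega, show n - 1 - (n - 1 - j) = j by omega] at this
      refine ⟨this.1, ?_⟩
      rw [this.2]
      exact mul_ne_zero (pow_ne_zero _ (by norm_num)) (hf.nondegenerate _ (hW p hp))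
    set u : Jet (2 * n) := v - v.1 • solField F p with hu
    have u0 : u.1 = 0 := by simp [hu, solField_fst]
    have uker : ∀ w, cartanTwoForm h F f p ![u, w] = 0 := by
      intro w
      rw [hu, ← twoFormBilin_apply, map_sub, map_smul, LinearMap.sub_apply, LinearMap.smul_apply,
        twoFormBilin_apply, twoFormBilin_apply, hv, hX p hp, smul_zero, sub_zero]
    have formula : ∀ k, ∑ i ∈ Finset.range n, (fderiv ℝ (momentum h F f (i + 1)) p u *
        Jet.coord (2 * n) i (Jet.back (2 * n) k) - fderiv ℝ (momentum h F f (i + 1)) p (Jet.back (2 * n) k) *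
          Jet.coord (2 * n) i u) = 0 := by
      intro k
      rw [← uker (Jet.back _ k), apply]
      refine Finset.sum_congr rfl fun i _ => ?_
      rw [u0]
      simp
    have main : ∀ i < 2 * n, Jet.coord _ i u = 0 := by
      intro i
      induction i using Nat.strong_induction_on with
      | _ i ih =>
        intro hi
        -- For i < n, pairing u with ∂/∂y_{2n-1-i} leaves only -dE_{i+1}(∂/∂y_{2n-1-i}) u_i. For i ≥
        -- n, pairing with ∂/∂y_j, j = 2n - 1 - i, leaves dE_{j+1}(u), in which only u_i remains.
        rcases Nat.lt_or_ge i n with hin | hin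
        · have h1 := formula i
          rw [Finset.sum_eq_single i] at h1
          · rw [Jet.coord_back hi, if_neg (by omega)] at h1
            simpa [(top i hin).2] using h1
          · intro j hj hji
            have hj := Finset.mem_range.1 hj
            rw [Jet.coord_back (by omega), if_neg (by omega)]
            rcases Nat.lt_or_ge i j with hij | hij
            · rw [(top j hj).1 i hij]; ring
            · rw [ih j (by omega) (by omega)]; ring
          · intro hh; exact absurd (Finset.mem_range.2 hin) hh
        · set j := 2 * n - 1 - i with hj
          have hjn : j < n := by omega
          have h1 := formula i
          have hl : ∀ l ∈ Finset.range n, Jet.coord _ l u = 0 := fun l hl =>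
            ih l (by have := Finset.mem_range.1 hl; omega) (by have := Finset.mem_range.1 hl; omega)
          rw [Finset.sum_eq_single j] at h1
          · rw [hl j (Finset.mem_range.2 hjn), Jet.coord_back (by omega), if_pos (by omega),
              Jet.eq_sum_back u u0, map_sum, Finset.sum_eq_single ⟨i, hi⟩] at h1
            · rw [map_smul, smul_eq_mul, ← Jet.coord_apply hi] at h1
              simpa [← hj, (top j hjn).2] using h1
            · intro l _ hli
              rw [map_smul, smul_eq_mul]
              rcases Nat.lt_or_ge l i with h2 | h2
              · have := ih l h2 l.2
                rw [Jet.coord_apply l.2] at this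
                rw [this, zero_mul]
              · have : (l : ℕ) ≠ i := fun hh => hli (Fin.ext hh)
                rw [(top j hjn).1 _ (by omega), mul_zero]
            · simp
          · intro l hl' hlj
            have := Finset.mem_range.1 hl'
            rw [hl l hl', Jet.coord_back (by omega), if_neg (by omega)]
            ring
          · intro hh; exact absurd (Finset.mem_range.2 hjn) hh
    have uz : u = 0 := by
      ext i
      · exact u0
      · rw [← Jet.coord_apply i.2, main i i.2]; rfl
    exact mem_solutionLine.2 (sub_eq_zero.1 uz)
  · rw [mem_solutionLine.1 hv, ← twoFormBilin_apply, map_smul, LinearMap.smul_apply,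
      twoFormBilin_apply, hX p hp, smul_zero]
  · rw [cartanTwoForm_apply hf hF hEL hn0 (hW p hp)]
    refine Finset.sum_eq_zero fun i hi => ?_
    have := Finset.mem_range.1 hi
    have hi2 : i < 2 * n := by omega
    rw [Jet.coord_apply hi2, Jet.coord_apply hi2, hv.2 ⟨i, hi2⟩ (by simp only; omega),
      hw.2 ⟨i, hi2⟩ (by simp only; omega), hv.1, hw.1]
    ring

end PoincareCartanForm

/-! ### Smooth dependence of pulled-back 2-forms -/

section Pullback

variable {E E' G : Type*} [NormedAddCommGroup E] [NormedSpace ℝ E]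
  [NormedAddCommGroup E'] [NormedSpace ℝ E'] [NormedAddCommGroup G] [NormedSpace ℝ G]

/-- The bilinear map underlying a 2-form, as a continuous linear function of the form. -/
def curryTwoForm : (E [⋀^Fin 2]→L[ℝ] ℝ) →L[ℝ] (E →L[ℝ] E →L[ℝ] ℝ) :=
  (ContinuousLinearMap.compL ℝ E (E [⋀^Fin 1]→L[ℝ] ℝ) (E →L[ℝ] ℝ)
    (ContinuousAlternatingMap.ofSubsingletonLIE (𝕜 := ℝ) (E := E) (F := ℝ)
      (0 : Fin 1)).symm.toContinuousLinearEquiv.toContinuousLinearMap).comp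
    (ContinuousAlternatingMap.curryLeftLI (𝕜 := ℝ) (E := E) (F := ℝ) (n := 1)).toContinuousLinearMap

/-- The antisymmetrization of a bilinear map. -/
def uncurryTwoForm : (E →L[ℝ] E →L[ℝ] ℝ) →L[ℝ] (E [⋀^Fin 2]→L[ℝ] ℝ) :=
  (ContinuousAlternatingMap.alternatizeUncurryFinCLM ℝ E ℝ).comp
    (ContinuousLinearMap.compL ℝ E (E →L[ℝ] ℝ) (E [⋀^Fin 1]→L[ℝ] ℝ)
    (ContinuousAlternatingMap.ofSubsingletonLIE (𝕜 := ℝ) (E := E) (F := ℝ)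
      (0 : Fin 1)).toContinuousLinearEquiv.toContinuousLinearMap)

theorem curryTwoForm_apply (α : E [⋀^Fin 2]→L[ℝ] ℝ) (v w : E) :
    curryTwoForm α v w = α ![v, w] := by
  change α _ = _
  congr 1
  ext i
  fin_cases i <;> rfl

theorem uncurryTwoForm_apply (b : E →L[ℝ] E →L[ℝ] ℝ) (v w : E) :
    uncurryTwoForm b ![v, w] = b v w - b w v := by
  change ContinuousAlternatingMap.alternatizeUncurryFin _ _ = _
  rw [ContinuousAlternatingMap.alternatizeUncurryFin_apply, Fin.sum_univ_two]
  simp [Fin.removeNth, sub_eq_add_neg]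

theorem compContinuousLinearMap_pair (α : E [⋀^Fin 2]→L[ℝ] ℝ) (L : E' →L[ℝ] E) (v w : E') :
    α.compContinuousLinearMap L ![v, w] = α ![L v, L w] := by
  rw [ContinuousAlternatingMap.compContinuousLinearMap_apply]
  congr 1
  ext i
  fin_cases i <;> rfl

/-- Passing through bilinear maps makes the pullback a composition of continuous linear maps.
Antisymmetrizing doubles an alternating form, hence the factor 1/2. -/
theorem ContDiffAt.twoForm_comp {α : G → E [⋀^Fin 2]→L[ℝ] ℝ} {L : G → E' →L[ℝ] E} {p : G}
    (hα : ContDiffAt ℝ ∞ α p) (hL : ContDiffAt ℝ ∞ L p) :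
    ContDiffAt ℝ ∞ (fun q => (α q).compContinuousLinearMap (L q)) p := by
  have e : (fun q => (α q).compContinuousLinearMap (L q)) = fun q => (2⁻¹ : ℝ) •
      uncurryTwoForm (((ContinuousLinearMap.compL ℝ E' E ℝ).flip (L q)).comp
        ((curryTwoForm (α q)).comp (L q))) := by
    funext q
    refine twoForm_ext fun v w => ?_
    rw [compContinuousLinearMap_pair, ContinuousAlternatingMap.smul_apply, uncurryTwoForm_apply]
    simp only [ContinuousLinearMap.comp_apply, ContinuousLinearMap.flip_apply,
      ContinuousLinearMap.compL_apply, curryTwoForm_apply]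
    rw [twoForm_swap (α q) (L q w)]
    simp only [smul_eq_mul]
    ring
  rw [e]
  have h1 : ContDiff ℝ ∞ (fun b : E' →L[ℝ] E' →L[ℝ] ℝ => uncurryTwoForm b) := by
    fun_prop
  have h2 : ContDiff ℝ ∞ (fun b : E [⋀^Fin 2]→L[ℝ] ℝ => curryTwoForm b) := by
    fun_prop
  have h3 : ContDiff ℝ ∞ (fun l : E' →L[ℝ] E => (ContinuousLinearMap.compL ℝ E' E ℝ).flip l) := by
    fun_prop
  exact ContDiffAt.const_smul (2⁻¹ : ℝ) (h1.contDiffAt.comp p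
    ((h3.contDiffAt.comp p hL).clm_comp ((h2.contDiffAt.comp p hα).clm_comp hL)))

end Pullback

theorem hasMFDerivAt_opens_val {E : Type*} [NormedAddCommGroup E] [NormedSpace ℝ E]
    (W : TopologicalSpace.Opens E) (p : W) :
    HasMFDerivAt 𝓘(ℝ, E) 𝓘(ℝ, E) (Subtype.val : W → E) p (ContinuousLinearMap.id ℝ E) := by
  refine ⟨continuous_subtype_val.continuousAt, ?_⟩
  have h : writtenInExtChartAt 𝓘(ℝ, E) 𝓘(ℝ, E) p (Subtype.val : W → E) =ᶠ[𝓝 (p : E)] id := by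
    have : ((chartAt E (p : E)).subtypeRestr ⟨p⟩).target ∈ 𝓝 (p : E) :=
      ((chartAt E (p : E)).subtypeRestr ⟨p⟩).open_target.mem_nhds
        ((chartAt E (p : E)).map_subtype_source ⟨p⟩ (by simp))
    filter_upwards [this] with q hq
    exact (chartAt E (p : E)).subtypeRestr_symm_apply ⟨p⟩ hq
  exact ((hasFDerivAt_id (p : E)).congr_of_eventuallyEq h).hasFDerivWithinAt

/-! ### The projection to the solution space in charts -/

section SolutionManifoldCharts

variable {N : ℕ} {F : Jet N → ℝ} {W : TopologicalSpace.Opens (Jet N)}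

/-- The projection to the solution space followed by a chart. -/
def solChart (e : OpenPartialHomeomorph (Sol F W) (EuclideanSpace ℝ (Fin N))) (q : Jet N) :
    EuclideanSpace ℝ (Fin N) :=
  open scoped Classical in if h : q ∈ W then e (Sol.mk F W ⟨q, h⟩) else 0

theorem solChart_apply (e : OpenPartialHomeomorph (Sol F W) (EuclideanSpace ℝ (Fin N))) (p : W) :
    solChart e p = e (Sol.mk F W p) := by
  rw [solChart, dif_pos p.2]

theorem Sol.mk_surjective (Γ : Sol F W) : ∃ p, Sol.mk F W p = Γ := Quot.exists_rep Γ

theorem Sol.continuous_mk : Continuous (Sol.mk F W) := continuous_quot_mk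

theorem eventually_mem_source {e : OpenPartialHomeomorph (Sol F W) (EuclideanSpace ℝ (Fin N))}
    {p : W} (hp : Sol.mk F W p ∈ e.source) :
    ∀ᶠ q in 𝓝 (p : Jet N), ∃ h : q ∈ W, Sol.mk F W ⟨q, h⟩ ∈ e.source := by
  have h1 : IsOpen (Subtype.val '' (Sol.mk F W ⁻¹' e.source)) :=
    W.isOpen.isOpenMap_subtype_val _ (e.open_source.preimage Sol.continuous_mk)
  filter_upwards [h1.mem_nhds ⟨p, hp, rfl⟩] with q hq
  obtain ⟨q', hq', rfl⟩ := hq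
  exact ⟨q'.2, hq'⟩

variable [ChartedSpace (EuclideanSpace ℝ (Fin N)) (Sol F W)] [IsManifold (𝓡 N) ∞ (Sol F W)]
  {e : OpenPartialHomeomorph (Sol F W) (EuclideanSpace ℝ (Fin N))}
  (he : e ∈ atlas (EuclideanSpace ℝ (Fin N)) (Sol F W))
include he

theorem contDiffAt_solChart (hQ : IsQuotientManifold N F W) {p : W}
    (hp : Sol.mk F W p ∈ e.source) : ContDiffAt ℝ ∞ (solChart e) p := by
  have h1 : ContMDiffAt 𝓘(ℝ, Jet N) (𝓡 N) ∞ (fun q : W => solChart e q) p := by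
    have : (fun q : W => solChart e q) = e ∘ Sol.mk F W := funext (solChart_apply e)
    rw [this]
    exact (contMDiffAt_of_mem_maximalAtlas (IsManifold.subset_maximalAtlas he) hp).comp p (hQ.1 p)
  exact (contMDiffAt_subtype_iff.1 h1).contDiffAt

omit he in
theorem Sol.isManifold_one : IsManifold (𝓡 N) 1 (Sol F W) :=
  IsManifold.of_le (n := ∞) (by simp)

theorem fderiv_solChart (hQ : IsQuotientManifold N F W) {p : W}
    (hp : Sol.mk F W p ∈ e.source) (v : Jet N) : fderiv ℝ (solChart e) p v =
      mfderiv (𝓡 N) (𝓡 N) e (Sol.mk F W p) (solProjDeriv N F W p v) := by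
  have := Sol.isManifold_one (F := F) (W := W)
  have h1 : HasMFDerivAt 𝓘(ℝ, Jet N) (𝓡 N) (e ∘ Sol.mk F W) p
      ((mfderiv (𝓡 N) (𝓡 N) e (Sol.mk F W p)).comp (solProjDeriv N F W p)) :=
    HasMFDerivAt.comp p (mdifferentiableAt_atlas he hp).hasMFDerivAt
      ((hQ.1 p).mdifferentiableAt (by simp)).hasMFDerivAt
  have h2 : HasMFDerivAt 𝓘(ℝ, Jet N) (𝓡 N) (solChart e ∘ Subtype.val) p
      ((fderiv ℝ (solChart e) p).comp (ContinuousLinearMap.id ℝ (Jet N))) :=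
    HasMFDerivAt.comp p
      ((contDiffAt_solChart he hQ hp).differentiableAt (by simp)).hasFDerivAt.hasMFDerivAt
      (hasMFDerivAt_opens_val W p)
  have e1 : solChart e ∘ Subtype.val = e ∘ Sol.mk F W := funext (solChart_apply e)
  rw [e1] at h2
  exact congrArg (fun l : Jet N →L[ℝ] EuclideanSpace ℝ (Fin N) => l v) (hasMFDerivAt_unique h2 h1)

theorem fderiv_solChart_surjective (hQ : IsQuotientManifold N F W) {p : W}
    (hp : Sol.mk F W p ∈ e.source) : Function.Surjective (fderiv ℝ (solChart e) p) := by
  have := Sol.isManifold_one (F := F) (W := W)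
  intro y
  obtain ⟨x, hx⟩ := (mdifferentiable_of_mem_atlas (I := 𝓡 N) he).mfderiv_surjective hp y
  obtain ⟨v, hv⟩ := hQ.2 p x
  exact ⟨v, by rw [fderiv_solChart he hQ hp, hv, hx]⟩

theorem formInChart_apply (η : SolForm N F W) {Γ : Sol F W} (hΓ : Γ ∈ e.source)
    (a b : TangentSpace (𝓡 N) Γ) : formInChart η e (e Γ)
      ![(mfderiv (𝓡 N) (𝓡 N) e Γ a : EuclideanSpace ℝ (Fin N)), mfderiv (𝓡 N) (𝓡 N) e Γ b] =
      η Γ ![a, b] := by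
  have := Sol.isManifold_one (F := F) (W := W)
  have h1 := (mdifferentiable_of_mem_atlas (I := 𝓡 N) he).symm_comp_deriv hΓ
  have h2 : ∀ a : TangentSpace (𝓡 N) Γ, (mfderiv (𝓡 N) (𝓡 N) e.symm (e Γ)
      (mfderiv (𝓡 N) (𝓡 N) e Γ a) : EuclideanSpace ℝ (Fin N)) = a := fun a =>
    congrArg (fun l : TangentSpace (𝓡 N) Γ →L[ℝ] TangentSpace (𝓡 N) Γ => l a) h1
  have h3 : ∀ x y : EuclideanSpace ℝ (Fin N), ∀ Γ', Γ' = Γ →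
      (η Γ' : EuclideanSpace ℝ (Fin N) [⋀^Fin 2]→L[ℝ] ℝ) ![x, y] =
      (η Γ : EuclideanSpace ℝ (Fin N) [⋀^Fin 2]→L[ℝ] ℝ) ![x, y] := by
    rintro x y _ rfl; rfl
  rw [formInChart]
  refine (compContinuousLinearMap_pair (E := EuclideanSpace ℝ (Fin N))
    (E' := EuclideanSpace ℝ (Fin N)) _ _ _ _).trans ?_
  exact (h3 _ _ _ (e.left_inv hΓ)).trans (congrArg₂
    (fun x y => (η Γ : EuclideanSpace ℝ (Fin N) [⋀^Fin 2]→L[ℝ] ℝ) ![x, y]) (h2 a) (h2 b))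

theorem IsPullback.apply_eq {α : EqForm N} {η : SolForm N F W} (h : IsPullback F W α η)
    (hQ : IsQuotientManifold N F W) {p : W} (hp : Sol.mk F W p ∈ e.source) (v w : Jet N) :
    α p ![v, w] = formInChart η e (solChart e p)
      ![fderiv ℝ (solChart e) p v, fderiv ℝ (solChart e) p w] := by
  rw [h p v w, fderiv_solChart he hQ hp, fderiv_solChart he hQ hp, solChart_apply,
    formInChart_apply he η hp]

/-- A short integral curve of X through p stays in one leaf, so the projection is constant along it.
-/
theorem fderiv_solChart_solField (hQ : IsQuotientManifold N F W) (hF : ContDiffOn ℝ ∞ F W) {p : W}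
    (hp : Sol.mk F W p ∈ e.source) : fderiv ℝ (solChart e) p (solField F p) = 0 := by
  have hX : ContDiffAt ℝ 1 (solField F) p :=
    ((contDiffOn_solField hF).contDiffAt (W.isOpen.mem_nhds p.2)).of_le (by simp)
  obtain ⟨γ, h0, ε, hε, hγ⟩ :=
    hX.exists_forall_mem_closedBall_exists_eq_forall_mem_Ioo_hasDerivAt₀ 0
  have hd := hγ 0 (by constructor <;> linarith)
  have hc : γ ⁻¹' W ∈ 𝓝 (0 : ℝ) :=
    hd.continuousAt (W.isOpen.mem_nhds (by rw [h0]; exact p.2))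
  obtain ⟨δ, hδ, hball⟩ := Metric.mem_nhds_iff.1 hc
  have hconst : (solChart e ∘ γ) =ᶠ[𝓝 0] fun _ => solChart e p := by
    filter_upwards [Metric.ball_mem_nhds (0 : ℝ) (lt_min hδ hε)] with t ht
    have hmem : ∀ s ∈ Set.uIcc 0 t, |s| < min δ ε := by
      intro s hs
      rw [Metric.mem_ball, dist_zero_right, Real.norm_eq_abs] at ht
      refine lt_of_le_of_lt ?_ ht
      simpa using Set.abs_sub_left_of_mem_uIcc hs
    have hW : ∀ s ∈ Set.uIcc 0 t, γ s ∈ W := fun s hs =>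
      hball (by simpa using (hmem s hs).trans_le (min_le_left _ _))
    have hsame : SameSolution F W p ⟨γ t, hW t Set.right_mem_uIcc⟩ :=
      ⟨γ, 0, t, h0, rfl, fun s hs => ⟨hW s hs, _, solField_mem F _, hγ s (by
        have := abs_lt.1 ((hmem s hs).trans_le (min_le_right _ _))
        constructor <;> linarith)⟩⟩
    change solChart e (⟨γ t, hW t Set.right_mem_uIcc⟩ : W) = _
    rw [solChart_apply, solChart_apply]
    exact congrArg e (Quot.sound hsame).symm
  have h1 : HasDerivAt (solChart e ∘ γ) (fderiv ℝ (solChart e) (γ 0) (solField F (γ 0))) 0 :=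
    HasFDerivAt.comp_hasDerivAt 0 (by
      rw [h0]
      exact ((contDiffAt_solChart he hQ hp).differentiableAt (by simp)).hasFDerivAt) hd
  rw [h0] at h1
  exact h1.unique ((hasDerivAt_const (0 : ℝ) (solChart e p)).congr_of_eventuallyEq hconst)

/-- The differential of the projection to `Sol` restricted to the vectors without `∂/∂x` component
is an isomorphism. -/
theorem bijective_fderiv_solChart_inr (hQ : IsQuotientManifold N F W) (hF : ContDiffOn ℝ ∞ F W)
    {p : W} (hp : Sol.mk F W p ∈ e.source) : Function.Bijective
      ((fderiv ℝ (solChart e) p).comp (ContinuousLinearMap.inr ℝ ℝ (Fin N → ℝ))) := by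
  have hs : Function.Surjective
      ((fderiv ℝ (solChart e) p).comp (ContinuousLinearMap.inr ℝ ℝ (Fin N → ℝ))) := by
    intro y
    obtain ⟨v, hv⟩ := fderiv_solChart_surjective he hQ hp y
    -- Subtracting a multiple of X removes the ∂/∂x component and keeps the image.
    refine ⟨(v - v.1 • solField F p).2, ?_⟩
    have : ContinuousLinearMap.inr ℝ ℝ (Fin N → ℝ) (v - v.1 • solField F p).2 =
        v - v.1 • solField F p := by
      ext i
      · simp [solField_fst]
      · rfl
    rw [ContinuousLinearMap.comp_apply, this, map_sub, map_smul,
      fderiv_solChart_solField he hQ hF hp, smul_zero, sub_zero, hv]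
  exact ⟨(LinearMap.injective_iff_surjective_of_finrank_eq_finrank (by simp)).2 hs, hs⟩

theorem fderiv_solChart_eq_zero_iff (hQ : IsQuotientManifold N F W) (hF : ContDiffOn ℝ ∞ F W)
    {p : W} (hp : Sol.mk F W p ∈ e.source) (v : Jet N) :
    fderiv ℝ (solChart e) p v = 0 ↔ v ∈ solutionLine F (p : Jet N) := by
  rw [mem_solutionLine]
  constructor
  · intro hv
    have e1 : ContinuousLinearMap.inr ℝ ℝ (Fin N → ℝ) (v - v.1 • solField F p).2 =
        v - v.1 • solField F p := by
      ext i
      · simp [solField_fst]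
      · rfl
    have h1 := (bijective_fderiv_solChart_inr he hQ hF hp).1
      (a₁ := (v - v.1 • solField F p).2) (a₂ := 0) (by
        rw [ContinuousLinearMap.comp_apply, e1, map_sub, map_smul,
          fderiv_solChart_solField he hQ hF hp, hv, map_zero, smul_zero, sub_zero])
    rw [h1, map_zero] at e1
    exact (sub_eq_zero.1 e1.symm)
  · intro hv
    rw [hv, map_smul, fderiv_solChart_solField he hQ hF hp, smul_zero]

/-- A local section of the projection to `Sol`, in a chart. -/
theorem exists_section (hQ : IsQuotientManifold N F W) (hF : ContDiffOn ℝ ∞ F W)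
    {y : EuclideanSpace ℝ (Fin N)} (hy : y ∈ e.target) :
    ∃ σ : EuclideanSpace ℝ (Fin N) → Jet N, ContDiffAt ℝ ∞ σ y ∧
      ∀ᶠ z in 𝓝 y, (∃ h : σ z ∈ W, Sol.mk F W ⟨σ z, h⟩ ∈ e.source) ∧ solChart e (σ z) = z := by
  obtain ⟨p, hpy⟩ := Sol.mk_surjective (e.symm y)
  have hp : Sol.mk F W p ∈ e.source := by rw [hpy]; exact e.map_target hy
  -- The slice x = const is transversal to S, so the projection restricts to a local diffeomorphism
  -- on it; its local inverse is the section.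
  set i : (Fin N → ℝ) → Jet N := fun w => ((p : Jet N).1, w) with hi
  have hip : i (p : Jet N).2 = p := rfl
  have hid : HasFDerivAt i (ContinuousLinearMap.inr ℝ ℝ (Fin N → ℝ)) (p : Jet N).2 :=
    hasFDerivAt_prodMk_right _ _
  have his : ContDiff ℝ ∞ i := contDiff_const.prodMk contDiff_id
  set L : (Fin N → ℝ) ≃L[ℝ] EuclideanSpace ℝ (Fin N) :=
    (LinearEquiv.ofBijective _ (bijective_fderiv_solChart_inr he hQ hF hp)).toContinuousLinearEquiv
    with hL
  have hLc : (L : (Fin N → ℝ) →L[ℝ] EuclideanSpace ℝ (Fin N)) =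
      (fderiv ℝ (solChart e) p).comp (ContinuousLinearMap.inr ℝ ℝ (Fin N → ℝ)) := by
    ext; rfl
  have hcd : ContDiffAt ℝ ∞ (solChart e) p := contDiffAt_solChart he hQ hp
  have hA : ContDiffAt ℝ ∞ (solChart e ∘ i) (p : Jet N).2 :=
    ContDiffAt.comp _ (by rw [hip]; exact hcd) his.contDiffAt
  have hAd : HasFDerivAt (solChart e ∘ i) (L : (Fin N → ℝ) →L[ℝ] EuclideanSpace ℝ (Fin N))
      (p : Jet N).2 := by
    rw [hLc]
    exact HasFDerivAt.comp _ (by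
      rw [hip]; exact (hcd.differentiableAt (by simp)).hasFDerivAt) hid
  have hval : (solChart e ∘ i) (p : Jet N).2 = y := by
    change solChart e p = y
    rw [solChart_apply, hpy, e.right_inv hy]
  have hinv := hA.to_localInverse hAd (by simp)
  have hstrict : HasStrictFDerivAt (solChart e ∘ i)
      (L : (Fin N → ℝ) →L[ℝ] EuclideanSpace ℝ (Fin N)) (p : Jet N).2 :=
    hA.hasStrictFDerivAt' hAd (by simp)
  have hright := hstrict.eventually_right_inverse
  have himg := hA.localInverse_apply_image hAd (by simp)
  set τ := hA.localInverse hAd (by simp) with hτ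
  rw [hval] at hinv himg hright
  have hσ : ContDiffAt ℝ ∞ (fun z => i (τ z)) y := his.contDiffAt.comp y hinv
  refine ⟨fun z => i (τ z), hσ, ?_⟩
  have hmem : ∀ᶠ z in 𝓝 y, ∃ h : i (τ z) ∈ W, Sol.mk F W ⟨i (τ z), h⟩ ∈ e.source := by
    have h1 := eventually_mem_source hp
    have hc := hσ.continuousAt
    rw [ContinuousAt, himg, hip] at hc
    exact hc.eventually h1
  filter_upwards [hmem, hright] with z h1 h2
  exact ⟨h1, h2⟩

end SolutionManifoldCharts

/-! ### Correspondence between forms on the equation and on the solution space -/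

section Descent

variable {N : ℕ} {F : Jet N → ℝ} {W : TopologicalSpace.Opens (Jet N)}
  [ChartedSpace (EuclideanSpace ℝ (Fin N)) (Sol F W)] [IsManifold (𝓡 N) ∞ (Sol F W)]

theorem solProjDeriv_eq_zero_iff (hQ : IsQuotientManifold N F W) (hF : ContDiffOn ℝ ∞ F W)
    (p : W) (v : Jet N) : solProjDeriv N F W p v = 0 ↔ v ∈ solutionLine F (p : Jet N) := by
  have := Sol.isManifold_one (F := F) (W := W)
  have he := chart_mem_atlas (EuclideanSpace ℝ (Fin N)) (Sol.mk F W p)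
  have hp := mem_chart_source (EuclideanSpace ℝ (Fin N)) (Sol.mk F W p)
  rw [← fderiv_solChart_eq_zero_iff he hQ hF hp, fderiv_solChart he hQ hp]
  constructor
  · intro h
    rw [h]
    exact map_zero _
  · intro h
    exact (mdifferentiable_of_mem_atlas (I := 𝓡 N) he).mfderiv_injective hp
      (h.trans (map_zero _).symm)

theorem IsPullback.eventuallyEq {α : EqForm N} {η : SolForm N F W} (h : IsPullback F W α η)
    (hQ : IsQuotientManifold N F W)
    {e : OpenPartialHomeomorph (Sol F W) (EuclideanSpace ℝ (Fin N))}
    (he : e ∈ atlas (EuclideanSpace ℝ (Fin N)) (Sol F W)) {p : W}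
    (hp : Sol.mk F W p ∈ e.source) : α =ᶠ[𝓝 (p : Jet N)] fun q =>
      (formInChart η e (solChart e q)).compContinuousLinearMap (fderiv ℝ (solChart e) q) := by
  filter_upwards [eventually_mem_source hp] with q ⟨hq, hqe⟩
  refine twoForm_ext fun v w => ?_
  rw [compContinuousLinearMap_pair]
  exact h.apply_eq he hQ (p := ⟨q, hq⟩) hqe v w

/-- Locally α is the pullback of a chart expression of η by a smooth map, so smoothness and
closedness carry over. By nondegeneracy its kernel is that of the differential of the projection. -/
theorem IsAdaptedSymplectic.isAdaptedForm {i : ℕ} {α : EqForm N} {η : SolForm N F W}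
    (hη : IsAdaptedSymplectic F W i η) (h : IsPullback F W α η)
    (hQ : IsQuotientManifold N F W) (hF : ContDiffOn ℝ ∞ F W) : IsAdaptedForm F W i α := by
  have hform : ∀ p : W, ContDiffAt ℝ ∞ (formInChart η (chartAt _ (Sol.mk F W p)))
      (solChart (chartAt _ (Sol.mk F W p)) p) := by
    intro p
    have he := chart_mem_atlas (EuclideanSpace ℝ (Fin N)) (Sol.mk F W p)
    refine (hη.1.smooth _ he).contDiffAt ((chartAt _ (Sol.mk F W p)).open_target.mem_nhds ?_)
    rw [solChart_apply]
    exact (chartAt _ (Sol.mk F W p)).map_source (mem_chart_source _ _)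
  have hchart : ∀ p : W, ContDiffAt ℝ ∞ (solChart (chartAt _ (Sol.mk F W p))) p := fun p =>
    contDiffAt_solChart (chart_mem_atlas _ _) hQ (mem_chart_source _ _)
  have heq := fun p : W => h.eventuallyEq hQ (chart_mem_atlas _ (Sol.mk F W p))
    (mem_chart_source _ _)
  refine ⟨fun p hp => ContDiffAt.contDiffWithinAt ?_, fun p hp => ?_, fun p hp v => ?_,
    fun p hp v hv w hw => ?_⟩
  · refine ContDiffAt.congr_of_eventuallyEq ?_ (heq ⟨p, hp⟩)
    exact ((hform ⟨p, hp⟩).comp p (hchart ⟨p, hp⟩)).twoForm_comp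
      ((hchart ⟨p, hp⟩).fderiv_right (m := ∞) (by simp))
  · rw [(heq ⟨p, hp⟩).extDeriv_eq, extDeriv_pullback
      ((hform ⟨p, hp⟩).differentiableAt (by simp)) (hchart ⟨p, hp⟩) minSmoothness_two_le_infty,
      hη.1.closed _ (chart_mem_atlas _ _)]
    · rfl
    · rw [solChart_apply _ ⟨p, hp⟩]
      exact (chartAt _ (Sol.mk F W ⟨p, hp⟩)).map_source (mem_chart_source _ _)
  · rw [← solProjDeriv_eq_zero_iff hQ hF ⟨p, hp⟩]
    constructor
    · intro hv
      refine hη.1.nondegenerate _ _ fun w => ?_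
      obtain ⟨w', rfl⟩ := hQ.2 ⟨p, hp⟩ w
      rw [← h ⟨p, hp⟩]
      exact hv w'
    · intro hv w
      rw [h ⟨p, hp⟩ v w, hv]
      exact (η _).map_coord_zero 0 rfl
  · rw [h ⟨p, hp⟩ v w]
    exact (hη.2 ⟨p, hp⟩ _).1 ⟨v, hv, rfl⟩ _ ⟨w, hw, rfl⟩

/-- The projection composed with σ is the identity, so pulling α back along σ recovers η; regularity
of α thus passes to η. -/
theorem IsPullback.formInChart_eventuallyEq {α : EqForm N} {η : SolForm N F W}
    (h : IsPullback F W α η) (hQ : IsQuotientManifold N F W)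
    {e : OpenPartialHomeomorph (Sol F W) (EuclideanSpace ℝ (Fin N))}
    (he : e ∈ atlas (EuclideanSpace ℝ (Fin N)) (Sol F W)) {y : EuclideanSpace ℝ (Fin N)}
    {σ : EuclideanSpace ℝ (Fin N) → Jet N} (hσ : ContDiffAt ℝ ∞ σ y)
    (hs : ∀ᶠ z in 𝓝 y, (∃ h : σ z ∈ W, Sol.mk F W ⟨σ z, h⟩ ∈ e.source) ∧
      solChart e (σ z) = z) :
    formInChart η e =ᶠ[𝓝 y] fun z => (α (σ z)).compContinuousLinearMap (fderiv ℝ σ z) := by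
  have hdiff : ∀ᶠ z in 𝓝 y, DifferentiableAt ℝ σ z := by
    filter_upwards [(hσ.of_le (m := 1) (by simp)).eventually (by simp)] with z hz
    exact hz.differentiableAt (by simp)
  filter_upwards [hs.eventually_nhds, hdiff] with z hz hd
  obtain ⟨⟨hW, hsrc⟩, hval⟩ := hz.self_of_nhds
  have hc : DifferentiableAt ℝ (solChart e) (σ z) :=
    (contDiffAt_solChart he hQ (p := ⟨σ z, hW⟩) hsrc).differentiableAt (by simp)
  have hid : (fderiv ℝ (solChart e) (σ z)).comp (fderiv ℝ σ z) =
      ContinuousLinearMap.id ℝ (EuclideanSpace ℝ (Fin N)) := by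
    have h1 := hc.hasFDerivAt.comp z hd.hasFDerivAt
    exact h1.unique ((hasFDerivAt_id z).congr_of_eventuallyEq (hz.mono fun _ h => h.2))
  have hid' : ∀ a, fderiv ℝ (solChart e) (σ z) (fderiv ℝ σ z a) = a := fun a =>
    congrArg (fun l : EuclideanSpace ℝ (Fin N) →L[ℝ] EuclideanSpace ℝ (Fin N) => l a) hid
  refine twoForm_ext fun a b => ?_
  rw [compContinuousLinearMap_pair, h.apply_eq he hQ (p := ⟨σ z, hW⟩) hsrc]
  simp only [hid', hval]

theorem IsPullback.isSymplecticForm {i : ℕ} {α : EqForm N} {η : SolForm N F W}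
    (h : IsPullback F W α η) (hα : IsAdaptedForm F W i α) (hQ : IsQuotientManifold N F W)
    (hF : ContDiffOn ℝ ∞ F W) : IsSymplecticForm η := by
  refine ⟨fun e he y hy => ContDiffAt.contDiffWithinAt ?_, fun e he y hy => ?_, fun Γ v hv => ?_⟩
  · obtain ⟨σ, hσ, hs⟩ := exists_section he hQ hF hy
    obtain ⟨⟨hW, -⟩, -⟩ := hs.self_of_nhds
    refine ContDiffAt.congr_of_eventuallyEq ?_ (h.formInChart_eventuallyEq hQ he hσ hs)
    exact ((hα.smooth.contDiffAt (W.isOpen.mem_nhds hW)).comp y hσ).twoForm_comp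
      (hσ.fderiv_right (m := ∞) (by simp))
  · obtain ⟨σ, hσ, hs⟩ := exists_section he hQ hF hy
    obtain ⟨⟨hW, -⟩, -⟩ := hs.self_of_nhds
    rw [(h.formInChart_eventuallyEq hQ he hσ hs).extDeriv_eq, extDeriv_pullback
      (hα.differentiableAt hW) hσ minSmoothness_two_le_infty, hα.closed _ hW]
    rfl
  · obtain ⟨p, rfl⟩ := Sol.mk_surjective Γ
    obtain ⟨v', rfl⟩ := hQ.2 p v
    rw [solProjDeriv_eq_zero_iff hQ hF, ← hα.ker_eq p p.2]
    intro w
    rw [h p v' w]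
    exact hv _

/-- Isotropy is the vanishing on V^n. For maximality, an orthogonal vector has a lift without ∂/∂x
component, which `snd_eq_zero_of_vertical` places in V^n. -/
theorem IsPullback.isAdaptedSymplectic {n : ℕ} (hn : 0 < n) {F : Jet (2 * n) → ℝ}
    {W : TopologicalSpace.Opens (Jet (2 * n))}
    [ChartedSpace (EuclideanSpace ℝ (Fin (2 * n))) (Sol F W)]
    [IsManifold (𝓡 (2 * n)) ∞ (Sol F W)] {α : EqForm (2 * n)} {η : SolForm (2 * n) F W}
    (h : IsPullback F W α η) (hα : IsAdaptedForm F W n α) (hQ : IsQuotientManifold (2 * n) F W)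
    (hF : ContDiffOn ℝ ∞ F W) : IsAdaptedSymplectic F W n η := by
  refine ⟨h.isSymplecticForm hα hQ hF, fun p v => ⟨?_, fun hv => ?_⟩⟩
  · rintro ⟨v', hv', rfl⟩ w ⟨w', hw', rfl⟩
    exact (h p v' w').symm.trans (hα.vanish p p.2 v' hv' w' hw')
  · obtain ⟨v', rfl⟩ := hQ.2 p v
    set u : Jet (2 * n) := v' - v'.1 • solField F p with hu
    have hXz : solProjDeriv (2 * n) F W p (solField F p) = 0 :=
      (solProjDeriv_eq_zero_iff hQ hF p _).2 (solField_mem F _)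
    have huv : solProjDeriv (2 * n) F W p u = solProjDeriv (2 * n) F W p v' := by
      rw [hu, map_sub, map_smul, hXz, smul_zero, sub_zero]
    have u0 : u.1 = 0 := by simp [hu, solField_fst]
    have hd : ∀ q ∈ W, DifferentiableAt ℝ F q := fun q hq =>
      (hF.contDiffAt (W.isOpen.mem_nhds hq)).differentiableAt (by simp)
    have hz := hα.snd_eq_zero_of_vertical hd hn p.2 u0 (fun l hl => by
      rw [h p, huv]
      exact hv _ ⟨Jet.back (2 * n) l, ⟨rfl, fun i hi => by
        rw [Jet.back_snd, if_neg (by omega)]⟩, rfl⟩)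
    exact ⟨u, ⟨u0, fun k hk => hz k (by omega)⟩, huv⟩

/-- The lift of vectors from a chart of `Sol` to vectors without `∂/∂x` component. -/
def solLift (e : OpenPartialHomeomorph (Sol F W) (EuclideanSpace ℝ (Fin N))) (q : Jet N) :
    EuclideanSpace ℝ (Fin N) →L[ℝ] Jet N :=
  (ContinuousLinearMap.inr ℝ ℝ (Fin N → ℝ)).comp (ContinuousLinearMap.inverse
    ((fderiv ℝ (solChart e) q).comp (ContinuousLinearMap.inr ℝ ℝ (Fin N → ℝ))))

variable {e : OpenPartialHomeomorph (Sol F W) (EuclideanSpace ℝ (Fin N))}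
  (he : e ∈ atlas (EuclideanSpace ℝ (Fin N)) (Sol F W))
include he

theorem exists_equiv_fderiv_solChart (hQ : IsQuotientManifold N F W) (hF : ContDiffOn ℝ ∞ F W)
    {p : W} (hp : Sol.mk F W p ∈ e.source) :
    ∃ L : (Fin N → ℝ) ≃L[ℝ] EuclideanSpace ℝ (Fin N),
      (L : (Fin N → ℝ) →L[ℝ] EuclideanSpace ℝ (Fin N)) =
        (fderiv ℝ (solChart e) p).comp (ContinuousLinearMap.inr ℝ ℝ (Fin N → ℝ)) :=
  ⟨(LinearEquiv.ofBijective _ (bijective_fderiv_solChart_inr he hQ hF hp)).toContinuousLinearEquiv,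
    by ext; rfl⟩

theorem fderiv_solChart_solLift (hQ : IsQuotientManifold N F W) (hF : ContDiffOn ℝ ∞ F W)
    {p : W} (hp : Sol.mk F W p ∈ e.source) (ξ : EuclideanSpace ℝ (Fin N)) :
    fderiv ℝ (solChart e) p (solLift e p ξ) = ξ := by
  obtain ⟨L, hL⟩ := exists_equiv_fderiv_solChart he hQ hF hp
  have h1 : fderiv ℝ (solChart e) p (solLift e p ξ) =
      ((fderiv ℝ (solChart e) p).comp (ContinuousLinearMap.inr ℝ ℝ (Fin N → ℝ)))
        (ContinuousLinearMap.inverse ((fderiv ℝ (solChart e) p).comp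
          (ContinuousLinearMap.inr ℝ ℝ (Fin N → ℝ))) ξ) := rfl
  rw [h1, ← hL, ContinuousLinearMap.inverse_equiv]
  simp

theorem differentiableAt_solLift (hQ : IsQuotientManifold N F W) (hF : ContDiffOn ℝ ∞ F W)
    {p : W} (hp : Sol.mk F W p ∈ e.source) (ξ : EuclideanSpace ℝ (Fin N)) :
    DifferentiableAt ℝ (fun q => solLift e q ξ) (p : Jet N) := by
  obtain ⟨L, hL⟩ := exists_equiv_fderiv_solChart he hQ hF hp
  have h1 : DifferentiableAt ℝ (fun q => (fderiv ℝ (solChart e) q).comp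
      (ContinuousLinearMap.inr ℝ ℝ (Fin N → ℝ))) (p : Jet N) :=
    (((contDiffAt_solChart he hQ hp).fderiv_right (m := ∞) (by simp)).differentiableAt
      (by simp)).clm_comp (differentiableAt_const _)
  have h2 : DifferentiableAt ℝ (ContinuousLinearMap.inverse :
      ((Fin N → ℝ) →L[ℝ] EuclideanSpace ℝ (Fin N)) → _)
      ((fderiv ℝ (solChart e) p).comp (ContinuousLinearMap.inr ℝ ℝ (Fin N → ℝ))) := by
    rw [← hL]
    exact (contDiffAt_map_inverse (n := 1) L).differentiableAt (by simp)
  have h3 := (DifferentiableAt.comp (p : Jet N) h2 h1).clm_apply (differentiableAt_const ξ)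
  exact (ContinuousLinearMap.inr ℝ ℝ (Fin N → ℝ)).differentiableAt.comp _ h3

/-- X projects to 0 and the lift to the constant ξ, so their bracket projects to [0, ξ] = 0. -/
theorem lieBracket_solField_solLift_mem (hQ : IsQuotientManifold N F W) (hF : ContDiffOn ℝ ∞ F W)
    {p : W} (hp : Sol.mk F W p ∈ e.source) (ξ : EuclideanSpace ℝ (Fin N)) :
    VectorField.lieBracket ℝ (solField F) (fun q => solLift e q ξ) p ∈
      solutionLine F (p : Jet N) := by
  rw [← fderiv_solChart_eq_zero_iff he hQ hF hp]
  have hC := contDiffAt_solChart he hQ hp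
  have h2 : DifferentiableAt ℝ (fderiv ℝ (solChart e)) (p : Jet N) :=
    (hC.fderiv_right (m := ∞) (by simp)).differentiableAt (by simp)
  have hFd : DifferentiableAt ℝ F (p : Jet N) :=
    (hF.contDiffAt (W.isOpen.mem_nhds p.2)).differentiableAt (by simp)
  have hX : HasFDerivAt (solField F) (fderiv ℝ (solField F) p) (p : Jet N) :=
    (hasFDerivAt_solField hFd).differentiableAt.hasFDerivAt
  have hL := (differentiableAt_solLift he hQ hF hp ξ).hasFDerivAt
  have d1 := h2.hasFDerivAt.clm_apply hX
  have d2 := h2.hasFDerivAt.clm_apply hL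
  have z1 := d1.unique ((hasFDerivAt_const (0 : EuclideanSpace ℝ (Fin N))
    (p : Jet N)).congr_of_eventuallyEq (by
    filter_upwards [eventually_mem_source hp] with q ⟨hq, hqe⟩
    exact fderiv_solChart_solField he hQ hF (p := ⟨q, hq⟩) hqe))
  have z2 := d2.unique ((hasFDerivAt_const ξ (p : Jet N)).congr_of_eventuallyEq (by
    filter_upwards [eventually_mem_source hp] with q ⟨hq, hqe⟩
    exact fderiv_solChart_solLift he hQ hF (p := ⟨q, hq⟩) hqe ξ))
  have w1 := congrArg (fun l : Jet N →L[ℝ] EuclideanSpace ℝ (Fin N) => l (solLift e p ξ)) z1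
  have w2 := congrArg (fun l : Jet N →L[ℝ] EuclideanSpace ℝ (Fin N) => l (solField F p)) z2
  simp only [add_apply, ContinuousLinearMap.comp_apply, ContinuousLinearMap.flip_apply,
    zero_apply] at w1 w2
  have hsymm : IsSymmSndFDerivAt ℝ (solChart e) (p : Jet N) :=
    hC.isSymmSndFDerivAt minSmoothness_two_le_infty
  rw [hsymm.eq (solField F p)] at w2
  rw [VectorField.lieBracket, map_sub, sub_eq_zero]
  exact add_right_cancel (w2.trans w1.symm)

/-- In L_X α = 0 the bracket terms drop out, since the brackets of X with the lifts lie in the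
kernel. Hence α on two lifts has zero derivative along the leaf. -/
theorem IsAdaptedForm.solLift_eq_of_sameSolution {i : ℕ} {α : EqForm N}
    (hα : IsAdaptedForm F W i α) (hQ : IsQuotientManifold N F W) (hF : ContDiffOn ℝ ∞ F W)
    {p q : W} (hpq : SameSolution F W p q) (hp : Sol.mk F W p ∈ e.source)
    (ξ ζ : EuclideanSpace ℝ (Fin N)) :
    α p ![solLift e p ξ, solLift e p ζ] = α q ![solLift e q ξ, solLift e q ζ] := by
  obtain ⟨γ, a, b, ha, hb, hγ⟩ := hpq
  set H : Jet N → ℝ := fun r => α r ![solLift e r ξ, solLift e r ζ] with hH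
  have hsrc : ∀ t (ht : t ∈ Set.uIcc a b), Sol.mk F W ⟨γ t, (hγ t ht).1⟩ ∈ e.source := by
    intro t ht
    -- Initial arcs of γ are admissible too, so the whole curve stays over the chart domain.
    have : Sol.mk F W p = Sol.mk F W ⟨γ t, (hγ t ht).1⟩ :=
      Quot.sound ⟨γ, a, t, ha, rfl, fun s hs => hγ s (Set.uIcc_subset_uIcc_left ht hs)⟩
    rw [← this]
    exact hp
  have hder : ∀ t ∈ Set.uIcc a b, HasDerivAt (H ∘ γ) 0 t := by
    intro t ht
    obtain ⟨hW, v, hv, hd⟩ := hγ t ht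
    have hs : Sol.mk F W ⟨γ t, hW⟩ ∈ e.source := hsrc t ht
    have hl := fun ξ => differentiableAt_solLift he hQ hF hs ξ
    have hFd : DifferentiableAt ℝ F (γ t) :=
      (hF.contDiffAt (W.isOpen.mem_nhds hW)).differentiableAt (by simp)
    have hHd : DifferentiableAt ℝ H (γ t) := by
      have e1 : H = fun r => curryTwoForm (α r) (solLift e r ξ) (solLift e r ζ) := by
        funext r; rw [curryTwoForm_apply]
      have hc : DifferentiableAt ℝ (fun b : (Jet N) [⋀^Fin 2]→L[ℝ] ℝ => curryTwoForm b)
          (α (γ t)) := by fun_prop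
      rw [e1]
      exact ((DifferentiableAt.comp (γ t) hc (hα.differentiableAt hW)).clm_apply
        (hl ξ)).clm_apply (hl ζ)
    have h1 := extDeriv_apply_of_ker (hα.differentiableAt hW)
      (hasFDerivAt_solField hFd).differentiableAt (hl ξ) (hl ζ) (hα.eventually_solField_apply hW)
    have b1 := (hα.ker_eq _ hW _).2 (lieBracket_solField_solLift_mem he hQ hF hs ξ)
    have b2 := (hα.ker_eq _ hW _).2 (lieBracket_solField_solLift_mem he hQ hF hs ζ)
    rw [hα.closed _ hW, b1, twoForm_swap _ _ (VectorField.lieBracket _ _ _ _), b2, neg_zero,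
      sub_zero, sub_zero] at h1
    have h2 := hHd.hasFDerivAt.comp_hasDerivAt t hd
    have h3 : fderiv ℝ H (γ t) v = 0 := by
      rw [mem_solutionLine.1 hv, map_smul, ← h1]
      simp
    rwa [h3] at h2
  have hconst := (convex_uIcc a b).norm_image_sub_le_of_norm_hasDerivWithin_le (C := 0)
    (fun t ht => (hder t ht).hasDerivWithinAt) (by simp) Set.left_mem_uIcc Set.right_mem_uIcc
  rw [zero_mul, norm_le_zero_iff, sub_eq_zero] at hconst
  simp only [Function.comp_apply, ha, hb] at hconst
  exact hconst.symm

/-- Equality in the quotient means the generated equivalence, so the invariance is extended by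
induction over it; `SameSolution` itself need not be shown transitive. -/
theorem IsAdaptedForm.solLift_eq {i : ℕ} {α : EqForm N}
    (hα : IsAdaptedForm F W i α) (hQ : IsQuotientManifold N F W) (hF : ContDiffOn ℝ ∞ F W)
    {p q : W} (hpq : Sol.mk F W p = Sol.mk F W q) (hp : Sol.mk F W p ∈ e.source)
    (ξ ζ : EuclideanSpace ℝ (Fin N)) :
    α p ![solLift e p ξ, solLift e p ζ] = α q ![solLift e q ξ, solLift e q ζ] := by
  have h := Quot.eqvGen_exact hpq
  clear hpq
  induction h with
  | rel x y hxy => exact hα.solLift_eq_of_sameSolution he hQ hF hxy hp ξ ζ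
  | refl x => rfl
  | symm x y hxy ih =>
    have : Sol.mk F W x = Sol.mk F W y := Quot.eqvGen_sound hxy
    exact (ih (this ▸ hp)).symm
  | trans x y z hxy hyz ih1 ih2 =>
    have : Sol.mk F W x = Sol.mk F W y := Quot.eqvGen_sound hxy
    exact (ih1 hp).trans (ih2 (this ▸ hp))

theorem IsAdaptedForm.apply_solLift {i : ℕ} {α : EqForm N}
    (hα : IsAdaptedForm F W i α) (hQ : IsQuotientManifold N F W) (hF : ContDiffOn ℝ ∞ F W)
    {p : W} (hp : Sol.mk F W p ∈ e.source) (v w : Jet N) :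
    α p ![solLift e p (fderiv ℝ (solChart e) p v), solLift e p (fderiv ℝ (solChart e) p w)] =
      α p ![v, w] := by
  have key : ∀ v w : Jet N, α p ![solLift e p (fderiv ℝ (solChart e) p v), w] = α p ![v, w] := by
    intro v w
    have hk : solLift e p (fderiv ℝ (solChart e) p v) - v ∈ solutionLine F (p : Jet N) := by
      rw [← fderiv_solChart_eq_zero_iff he hQ hF hp, map_sub,
        fderiv_solChart_solLift he hQ hF hp, sub_self]
    have := (hα.ker_eq p p.2 _).2 hk w
    rw [← twoFormBilin_apply, map_sub, LinearMap.sub_apply, sub_eq_zero] at this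
    exact this
  rw [key, twoForm_swap, key, twoForm_swap, neg_neg]

omit he

/-- An adapted form descends to the solution space. -/
theorem IsAdaptedForm.existsUnique_isPullback {i : ℕ} {α : EqForm N}
    (hα : IsAdaptedForm F W i α) (hQ : IsQuotientManifold N F W) (hF : ContDiffOn ℝ ∞ F W) :
    ∃! η : SolForm N F W, IsPullback F W α η := by
  choose rep hrep using Sol.mk_surjective (F := F) (W := W)
  -- An arbitrary representative of the leaf is used; `solLift_eq` makes the choice irrelevant.
  let η : SolForm N F W := fun Γ =>
    ((α (rep Γ)).compContinuousLinearMap (solLift (chartAt _ Γ) (rep Γ))).compContinuousLinearMap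
      (mfderiv (𝓡 N) (𝓡 N) (chartAt (EuclideanSpace ℝ (Fin N)) Γ) Γ)
  have hη : IsPullback F W α η := by
    intro p v w
    have he := chart_mem_atlas (EuclideanSpace ℝ (Fin N)) (Sol.mk F W p)
    have hp := mem_chart_source (EuclideanSpace ℝ (Fin N)) (Sol.mk F W p)
    rw [← hα.apply_solLift he hQ hF hp, hα.solLift_eq he hQ hF (hrep (Sol.mk F W p)).symm hp,
      fderiv_solChart he hQ hp, fderiv_solChart he hQ hp]
    exact (compContinuousLinearMap_pair _ _ _ _).symm.trans
      (compContinuousLinearMap_pair (E := EuclideanSpace ℝ (Fin N))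
        (E' := EuclideanSpace ℝ (Fin N)) _ _ _ _).symm
  refine ⟨η, hη, fun η' hη' => ?_⟩
  funext Γ
  obtain ⟨p, rfl⟩ := Sol.mk_surjective Γ
  refine twoForm_ext (E := EuclideanSpace ℝ (Fin N)) fun a b => ?_
  obtain ⟨v, rfl⟩ := hQ.2 p a
  obtain ⟨w, rfl⟩ := hQ.2 p b
  exact (hη' p v w).symm.trans (hη p v w)

omit [IsManifold (𝓡 N) ∞ (Sol F W)] in
/-- Every 2-form on the solution space has a pullback. -/
theorem exists_isPullback (η : SolForm N F W) : ∃ α : EqForm N, IsPullback F W α η := by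
  classical
  -- Pullbacks are tested only on W, so the value 0 elsewhere is arbitrary.
  refine ⟨fun q => if h : q ∈ W then (η (Sol.mk F W ⟨q, h⟩)).compContinuousLinearMap
    (solProjDeriv N F W ⟨q, h⟩) else 0, fun p v w => ?_⟩
  simp only [dif_pos p.2]
  exact compContinuousLinearMap_pair (E := EuclideanSpace ℝ (Fin N)) (E' := Jet N) _ _ _ _

end Descent

end

theorem mainTheorem6 (n : ℕ) (hn : 2 ≤ n)
    (f : Jet (n + 1) → ℝ) (U : Set (Jet (n + 1))) (hf : IsNondegenerateLagrangian f U)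
    (F : Jet (2 * n) → ℝ) (hF : IsEulerLagrangeEquation f U F)
    (W : TopologicalSpace.Opens (Jet (2 * n)))
    (hW : ∀ p ∈ W, Jet.proj (by omega : n + 1 ≤ 2 * n) p ∈ U)
    (hWconn : IsConnected (W : Set (Jet (2 * n)))) :
    (∃ α : EqForm (2 * n), IsAdaptedForm F W n α ∧
      ∀ α' : EqForm (2 * n), IsAdaptedForm F W n α' ↔
        ∃ c : ℝ, c ≠ 0 ∧ ∀ p ∈ W, α' p = c • α p) ∧
    (∀ [ChartedSpace (EuclideanSpace ℝ (Fin (2 * n))) (Sol F W)]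
      [IsManifold (𝓡 (2 * n)) ∞ (Sol F W)],
      IsQuotientManifold (2 * n) F W →
        (∃ η : SolForm (2 * n) F W, IsAdaptedSymplectic F W n η ∧
          ∀ η' : SolForm (2 * n) F W, IsAdaptedSymplectic F W n η' ↔
            ∃ c : ℝ, c ≠ 0 ∧ ∀ Γ, η' Γ = c • η Γ) ∧
        (∀ (α : EqForm (2 * n)) (η : SolForm (2 * n) F W), IsPullback F W α η →
          (IsAdaptedForm F W n α ↔ IsAdaptedSymplectic F W n η)) ∧
        (∀ α : EqForm (2 * n), IsAdaptedForm F W n α →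
          ∃! η : SolForm (2 * n) F W, IsPullback F W α η)) := by
  have h : n + 1 ≤ 2 * n := by omega
  have hn0 : 0 < n := by omega
  have hF' : ContDiffOn ℝ ∞ F W := (contDiffOn_solvedForm hf hF hn0).mono hW
  have hd : ∀ p ∈ W, DifferentiableAt ℝ F p := fun p hp =>
    (hF'.contDiffAt (W.isOpen.mem_nhds hp)).differentiableAt (by simp)
  have hα : IsAdaptedForm F W n (cartanTwoForm h F f) := isAdaptedForm_cartanTwoForm hf hF hn hW
  refine ⟨⟨_, hα, fun α' => ⟨fun hα' => hα.exists_eq_smul hd hα' hn hWconn,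
    fun ⟨c, hc, h⟩ => hα.const_smul hc h⟩⟩, ?_⟩
  intro _ _ hQ
  refine ⟨?_, fun α η hp => ⟨fun hα => hp.isAdaptedSymplectic hn0 hα hQ hF',
    fun hη => hη.isAdaptedForm hp hQ hF'⟩, fun α hα => hα.existsUnique_isPullback hQ hF'⟩
  obtain ⟨η, hη, -⟩ := hα.existsUnique_isPullback hQ hF'
  refine ⟨η, hη.isAdaptedSymplectic hn0 hα hQ hF', fun η' => ⟨fun hη' => ?_, ?_⟩⟩
  -- Uniqueness on W is applied to the pullback of η'; surjectivity of the projection and of its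
  -- differential returns the constant to `Sol`.
  · obtain ⟨α', hp⟩ := exists_isPullback η'
    obtain ⟨c, hc, hcα⟩ := hα.exists_eq_smul hd (hη'.isAdaptedForm hp hQ hF') hn hWconn
    refine ⟨c, hc, fun Γ => ?_⟩
    obtain ⟨p, rfl⟩ := Sol.mk_surjective Γ
    refine twoForm_ext (E := EuclideanSpace ℝ (Fin (2 * n))) fun a b => ?_
    obtain ⟨v, rfl⟩ := hQ.2 p a
    obtain ⟨w, rfl⟩ := hQ.2 p b
    refine (hp p v w).symm.trans ?_
    rw [hcα p p.2]
    exact congrArg (c * ·) (hη p v w)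
  · rintro ⟨c, hc, hcη⟩
    have hp : IsPullback F W (fun q => c • cartanTwoForm h F f q) η' := by
      intro p v w
      rw [hcη]
      exact congrArg (c * ·) (hη p v w)
    exact hp.isAdaptedSymplectic hn0 (hα.const_smul hc fun _ _ => rfl) hQ hF'
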